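/- Let $n\ge 0$ and let $(M,\pi,E)$ be a real analytic Jacobi manifold of dimension $2n+1$: $M$ is a Hausdorff, second countable real analytic manifold, $\pi$ a real analytic bivector field and $E$ a real analytic vector field with $[\pi,\pi]=2E\wedge\pi$ and $[E,\pi]=0$, where the Schouten bracket is normalized by $[\pi,\pi](df,dg,dh)=2\sum_{\mathrm{cyc}}\{f,\{g,h\}\}$ with $\{f,g\}=\pi(df,dg)$. A point of $M$ is called singular if $E\wedge\pi^n$ vanishes there, and the set of singular points is the singular locus. Assume that $(\pi,E)$ is contact on a dense open set, i.e. that there is a dense open subset of $M$ containing no singular point, and that the singular locus contains a nonempty embedded smooth submanifold of codimension $1$. Then $(M,\pi,E)$ admits no semi-connected contact resolution. That is, there is no triple $(\Sigma,\alpha,\varphi)$ such that $\Sigma$ is a Hausdorff, second countable real analytic manifold of dimension $2n+1$; $\alpha$ is a real analytic contact form on $\Sigma$ ($\alpha\wedge(d\alpha)^n$ vanishes nowhere); $\varphi:\Sigma\to M$ is a surjective real analytic Jacobi morphism, i.e. $\varphi_*\pi_\Sigma=\pi$ and $\varphi_*E_\Sigma=E$, where $(\pi_\Sigma,E_\Sigma)$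 is the Jacobi structure of $\alpha$ ($E_\Sigma$ is the Reeb field, $\pi_\Sigma(\alpha,\cdot)=0$, and $\pi_\Sigma(\iota_u d\alpha,\cdot)=u-\alpha(u)E_\Sigma$ for every tangent vector $u$); and no connected component of $\Sigma$ is mapped by $\varphi$ into the singular locus. -/

import Mathlib

open scoped Manifold ContDiff

namespace JacobiContact

section Wedge

/-- The wedge product `a ∧ b ∧ ⋯ ∧ b` (`n` factors `b`) of a linear form `a` and an alternating
bilinear form `b` on `V`, evaluated at `2n+1` vectors. -/
noncomputable def wedgePow {V : Type*} (n : ℕ) (a : V → ℝ) (b : V → V → ℝ)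
    (v : Fin (2 * n + 1) → V) : ℝ :=
  (1 / 2 ^ n : ℝ) * ∑ σ : Equiv.Perm (Fin (2 * n + 1)), ((Equiv.Perm.sign σ : ℤ) : ℝ) *
    (a (v (σ 0)) * ∏ i : Fin n,
      b (v (σ ⟨2 * (i : ℕ) + 1, by omega⟩)) (v (σ ⟨2 * (i : ℕ) + 2, by omega⟩)))

end Wedge

section Fields

variable (d : ℕ) (M : Type*) [TopologicalSpace M] [ChartedSpace (EuclideanSpace ℝ (Fin d)) M]

variable {M} in
/-- The cotangent space of a `d`-dimensional manifold at a point. -/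
abbrev CotangentSpace (x : M) : Type := TangentSpace (𝓡 d) x →L[ℝ] ℝ

/-- A vector field (no regularity is required here). -/
abbrev VectorField : Type _ := (x : M) → TangentSpace (𝓡 d) x

/-- A differential form of degree one (no regularity is required here). -/
abbrev OneForm : Type _ := (x : M) → CotangentSpace d x

/-- A field of contravariant `2`-tensors, seen as bilinear forms on the cotangent spaces (no
regularity is required here). It is a bivector field when all its values are alternating. -/
abbrev TwoTensorField : Type _ :=
  (x : M) → CotangentSpace d x →L[ℝ] CotangentSpace d x →L[ℝ] ℝ

variable {d M}

/-- The derivative `E(f)` of a function along a vector field. -/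
noncomputable def lieDeriv (E : VectorField d M) (f : M → ℝ) : M → ℝ :=
  fun x ↦ mvfderiv (𝓡 d) f x (E x)

/-- The function `{f, g} = π(df, dg)`. -/
noncomputable def bracket (π : TwoTensorField d M) (f g : M → ℝ) : M → ℝ :=
  fun x ↦ π x (mvfderiv (𝓡 d) f x) (mvfderiv (𝓡 d) g x)

/-- A vector field is real analytic if it maps germs of analytic functions to germs of analytic
functions; equivalently, its components in analytic charts are analytic. -/
def AnalyticVectorField (E : VectorField d M) : Prop :=
  ∀ (x : M) (f : M → ℝ), ContMDiffAt (𝓡 d) 𝓘(ℝ, ℝ) ω f x →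
    ContMDiffAt (𝓡 d) 𝓘(ℝ, ℝ) ω (lieDeriv E f) x

/-- A contravariant `2`-tensor field is real analytic if the bracket of two germs of analytic
functions is analytic; equivalently, its components in analytic charts are analytic. -/
def AnalyticTwoTensorField (π : TwoTensorField d M) : Prop :=
  ∀ (x : M) (f g : M → ℝ), ContMDiffAt (𝓡 d) 𝓘(ℝ, ℝ) ω f x → ContMDiffAt (𝓡 d) 𝓘(ℝ, ℝ) ω g x →
    ContMDiffAt (𝓡 d) 𝓘(ℝ, ℝ) ω (bracket π f g) x

/-- The `3`-vector `[π, π]` (Schouten bracket) evaluated at `df, dg, dh`. -/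
noncomputable def schoutenSelf (π : TwoTensorField d M) (f g h : M → ℝ) : M → ℝ :=
  fun x ↦ 2 * (bracket π f (bracket π g h) x + bracket π g (bracket π h f) x
    + bracket π h (bracket π f g) x)

/-- The bivector `[E, π] = L_E π` evaluated at `df, dg`. -/
noncomputable def lieDerivTensor (E : VectorField d M) (π : TwoTensorField d M)
    (f g : M → ℝ) : M → ℝ :=
  fun x ↦ lieDeriv E (bracket π f g) x - bracket π (lieDeriv E f) g x
    - bracket π f (lieDeriv E g) x

/-- The `3`-vector `E ∧ π` evaluated at `df, dg, dh`. -/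
noncomputable def wedgeVectorTensor (E : VectorField d M) (π : TwoTensorField d M)
    (f g h : M → ℝ) : M → ℝ :=
  fun x ↦ lieDeriv E f x * bracket π g h x + lieDeriv E g x * bracket π h f x
    + lieDeriv E h x * bracket π f g x

/-- `(π, E)` is a real analytic Jacobi structure: `π` is an analytic bivector field, `E` is an
analytic vector field, `[π, π] = 2 E ∧ π` and `[E, π] = 0`. The last two are equalities of
multivector fields, which are tested on differentials of functions. -/
structure IsAnalyticJacobi (π : TwoTensorField d M) (E : VectorField d M) : Prop where
  analytic_tensor : AnalyticTwoTensorField π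
  analytic_vector : AnalyticVectorField E
  alternating : ∀ (x : M) (β : CotangentSpace d x), π x β β = 0
  schouten_tensor : ∀ (x : M) (f g h : M → ℝ), ContMDiffAt (𝓡 d) 𝓘(ℝ, ℝ) ∞ f x →
    ContMDiffAt (𝓡 d) 𝓘(ℝ, ℝ) ∞ g x → ContMDiffAt (𝓡 d) 𝓘(ℝ, ℝ) ∞ h x →
    schoutenSelf π f g h x = 2 * wedgeVectorTensor E π f g h x
  schouten_vector : ∀ (x : M) (f g : M → ℝ), ContMDiffAt (𝓡 d) 𝓘(ℝ, ℝ) ∞ f x →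
    ContMDiffAt (𝓡 d) 𝓘(ℝ, ℝ) ∞ g x → lieDerivTensor E π f g x = 0

/-- The expression of a one-form in the preferred chart at `x`: its pullback under the inverse of
the chart. -/
noncomputable def localForm (α : OneForm d M) (x : M) (y : EuclideanSpace ℝ (Fin d)) :
    EuclideanSpace ℝ (Fin d) →L[ℝ] ℝ :=
  α ((extChartAt (𝓡 d) x).symm y) ∘L
    mfderiv 𝓘(ℝ, EuclideanSpace ℝ (Fin d)) (𝓡 d) (extChartAt (𝓡 d) x).symm y ∘L
      (NormedSpace.fromTangentSpace (𝕜 := ℝ) y).symm.toContinuousLinearMap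

/-- A one-form is real analytic if its expressions in charts are. -/
def AnalyticOneForm (α : OneForm d M) : Prop :=
  ∀ x : M, ContDiffOn ℝ ω (localForm α x) (extChartAt (𝓡 d) x).target

/-- The exterior derivative of a one-form at `x`,
`dα (u, v) = D_u α (v) - D_v α (u)` in the preferred chart at `x`. -/
noncomputable def extDerivForm (α : OneForm d M) (x : M) :
    TangentSpace (𝓡 d) x →L[ℝ] TangentSpace (𝓡 d) x →L[ℝ] ℝ :=
  let A := fderiv ℝ (localForm α x) (extChartAt (𝓡 d) x x)
  let D := mvfderiv (𝓡 d) (extChartAt (𝓡 d) x) x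
  D.precomp ℝ ∘L (A - A.flip) ∘L D

end Fields

section Contact

variable {n : ℕ} {M : Type*} [TopologicalSpace M]
  [ChartedSpace (EuclideanSpace ℝ (Fin (2 * n + 1))) M]

/-- A point of a `(2n+1)`-dimensional manifold is regular for `(π, E)` if the `(2n+1)`-vector
`E ∧ π^n` does not vanish there. -/
def IsRegularPoint (π : TwoTensorField (2 * n + 1) M) (E : VectorField (2 * n + 1) M)
    (x : M) : Prop :=
  ∃ β : Fin (2 * n + 1) → CotangentSpace (2 * n + 1) x,
    wedgePow n (fun γ : CotangentSpace (2 * n + 1) x ↦ γ (E x)) (fun γ δ ↦ π x γ δ) β ≠ 0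

/-- The singular locus of `(π, E)`. -/
def singularLocus (π : TwoTensorField (2 * n + 1) M) (E : VectorField (2 * n + 1) M) : Set M :=
  {x | ¬ IsRegularPoint π E x}

/-- The structure `(π, E)` is contact on a dense open set. -/
def IsContactOnDenseOpen (π : TwoTensorField (2 * n + 1) M)
    (E : VectorField (2 * n + 1) M) : Prop :=
  ∃ U : Set M, IsOpen U ∧ Dense U ∧ ∀ x ∈ U, IsRegularPoint π E x

/-- A real analytic contact form: `α ∧ (dα)^n` vanishes nowhere. -/
structure IsAnalyticContactForm (α : OneForm (2 * n + 1) M) : Prop where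
  analytic : AnalyticOneForm α
  nondegenerate : ∀ x : M, ∃ v : Fin (2 * n + 1) → TangentSpace (𝓡 (2 * n + 1)) x,
    wedgePow n (fun u ↦ α x u) (fun u w ↦ extDerivForm α x u w) v ≠ 0

/-- `(π, E)` is the Jacobi structure of the contact form `α`: `E` is the Reeb field of `α`, and `π`
is determined by `π(α, ·) = 0` and `π(ι_u dα, ·) = u - α(u) E`. For a contact form, these equations
have exactly one solution `(π, E)`, since `α` and the `ι_u dα` span the cotangent space. -/
structure IsJacobiOfContactForm (α : OneForm (2 * n + 1) M)
    (π : TwoTensorField (2 * n + 1) M) (E : VectorField (2 * n + 1) M) : Prop where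
  form_reeb : ∀ x : M, α x (E x) = 1
  extDeriv_reeb : ∀ x : M, extDerivForm α x (E x) = 0
  tensor_form : ∀ x : M, π x (α x) = 0
  tensor_extDeriv : ∀ (x : M) (u : TangentSpace (𝓡 (2 * n + 1)) x)
    (γ : CotangentSpace (2 * n + 1) x),
    π x (extDerivForm α x u) γ = γ u - α x u * γ (E x)

variable {S : Type*} [TopologicalSpace S]
  [ChartedSpace (EuclideanSpace ℝ (Fin (2 * n + 1))) S]

/-- A (real analytic) Jacobi morphism: an analytic map which projects the bivector field and the
vector field of its source onto those of its target. -/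
structure IsAnalyticJacobiMorphism (πS : TwoTensorField (2 * n + 1) S)
    (ES : VectorField (2 * n + 1) S) (π : TwoTensorField (2 * n + 1) M)
    (E : VectorField (2 * n + 1) M) (φ : S → M) : Prop where
  analytic : ContMDiff (𝓡 (2 * n + 1)) (𝓡 (2 * n + 1)) ω φ
  map_vector : ∀ s : S,
    mfderiv (𝓡 (2 * n + 1)) (𝓡 (2 * n + 1)) φ s (ES s) = E (φ s)
  map_tensor : ∀ (s : S) (β γ : CotangentSpace (2 * n + 1) (φ s)),
    πS s (β ∘L mfderiv (𝓡 (2 * n + 1)) (𝓡 (2 * n + 1)) φ s)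
      (γ ∘L mfderiv (𝓡 (2 * n + 1)) (𝓡 (2 * n + 1)) φ s) = π (φ s) β γ

/-- `(S, α, φ)` is a (real analytic) contact resolution of `(M, π, E)`: `α` is a contact form on the
manifold `S`, of the same dimension as `M`, and `φ : S → M` is a surjective Jacobi morphism for the
Jacobi structure of `α`. -/
structure IsContactResolution (π : TwoTensorField (2 * n + 1) M) (E : VectorField (2 * n + 1) M)
    (α : OneForm (2 * n + 1) S) (φ : S → M) : Prop where
  contact : IsAnalyticContactForm α
  surjective : Function.Surjective φ
  morphism : ∃ (πS : TwoTensorField (2 * n + 1) S) (ES : VectorField (2 * n + 1) S),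
    IsJacobiOfContactForm α πS ES ∧ IsAnalyticJacobiMorphism πS ES π E φ

/-- `φ` maps no connected component of its source into the singular locus of `(π, E)`. -/
def IsSemiConnected (π : TwoTensorField (2 * n + 1) M) (E : VectorField (2 * n + 1) M)
    (φ : S → M) : Prop :=
  ∀ s : S, ¬ φ '' connectedComponent s ⊆ singularLocus π E

end Contact

end JacobiContact

open JacobiContact

/-! ### Zero sets of real analytic functions are negligible. -/

section ZeroSets

open Set Filter Topology MeasureTheory

variable {V : Type*} [NormedAddCommGroup V] [NormedSpace ℝ V]

/-! Suppose a resolution exists. Since `φ` carries one Jacobi structure to the other and the source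
is contact, `φ` is a local diffeomorphism exactly over the regular points (`injective_mfderiv`,
`isRegularPoint`): its critical set is the preimage of the singular locus. By analyticity and
semi-connectedness this set has empty interior (`not_eventually_not_injective_mfderiv`).

The codimension-one submanifold makes the critical set large. A local map `ρ` to `ℝ^{2n}` sends a
piece of it to a set of positive measure (`exists_straightening`), and `φ` is surjective, so `ρ ∘ φ`
sends the critical set to a set of positive measure. Locally the critical set is the zero set of a
Jacobian determinant, hence is covered by countably many subsets of analytic hypersurfaces. A Sard
argument produces a hypersurface `p = 0` of critical points on which `ρ ∘ φ`, and so `φ`, is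
immersive at some point (`exists_hypersurface_of_image_zeros_ne_zero`). Near that point the kernel
of `dφ` along `p = 0` is a line transverse to it.

The Reeb field and the fields `π_S(φ^*γ, ·)` are `φ`-related to regular fields on the target. If one
of them is transverse to `p = 0`, the relation is an evolution equation in the transverse direction;
unique continuation then makes `φ` critical on a whole neighbourhood
(`not_injective_fderiv_of_related`), which is excluded. If all are tangent, `dp` kills the Reeb
vector and `π_S(dp, ·)` lies in the kernel of `dφ`. Skew-symmetry puts `π_S(dp, ·)` also in the
kernel of `dp`, so it vanishes by immersivity, and nondegeneracy of the contact form gives `dp = 0`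
(`covector_eq_zero`), a contradiction. -/

/-- An analytic function all of whose derivatives vanish at a point vanishes near that point. -/
theorem AnalyticAt.eventually_eq_zero_of_iteratedFDeriv {f : V → ℝ} {x : V}
    (hf : AnalyticAt ℝ f x) (h : ∀ k, iteratedFDeriv ℝ k f x = 0) : ∀ᶠ y in 𝓝 x, f y = 0 := by
  obtain ⟨q, r, hr⟩ := hf
  have hball := Metric.eball_mem_nhds x hr.r_pos
  filter_upwards [hball] with y hy
  have hy' : y - x ∈ Metric.eball (0 : V) r := by
    simpa [edist_eq_enorm_sub] using hy
  have hsum := hr.hasSum hy'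
  have hz : (fun k : ℕ ↦ q k fun _ ↦ y - x) = fun _ ↦ 0 := by
    funext k
    have := hr.factorial_smul (y - x) k
    rw [h k] at this
    simpa [Nat.factorial_ne_zero] using this
  rw [hz] at hsum
  simpa using hsum.unique hasSum_zero

/-- The zero set of an analytic function is covered by the orders of vanishing, each of which is
locally contained in an analytic hypersurface; so it is negligible as soon as its intersections
with small pieces of analytic hypersurfaces are. -/
theorem outerMeasure_zeros_eq_zero [SecondCountableTopology V] (μ : OuterMeasure V) {f : V → ℝ}
    {U : Set V} (hf : AnalyticOnNhd ℝ f U)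
    (hne : ∀ x ∈ U, ¬ ∀ᶠ y in 𝓝 x, f y = 0)
    (h : ∀ x ∈ U, ∀ g : V → ℝ, AnalyticAt ℝ g x → g x = 0 → fderiv ℝ g x ≠ 0 →
      ∃ u ∈ 𝓝 x, μ {y ∈ u | f y = 0 ∧ g y = 0} = 0) :
    μ {x ∈ U | f x = 0} = 0 := by
  -- `C k` is the set of zeros of order exactly `k + 1`.
  set C : ℕ → Set V := fun k ↦ {x ∈ U | (∀ j ≤ k, iteratedFDeriv ℝ j f x = 0) ∧
    iteratedFDeriv ℝ (k + 1) f x ≠ 0}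
  have hcover : {x ∈ U | f x = 0} ⊆ ⋃ k, C k := by
    rintro x ⟨hxU, hx0⟩
    have hex : ∃ k, iteratedFDeriv ℝ k f x ≠ 0 := by
      by_contra! hcon
      exact hne x hxU ((hf x hxU).eventually_eq_zero_of_iteratedFDeriv hcon)
    classical
    obtain ⟨k, hk⟩ : ∃ k, Nat.find hex = k + 1 := by
      refine Nat.exists_eq_succ_of_ne_zero fun h0 ↦ ?_
      have := Nat.find_spec hex
      rw [h0] at this
      exact this (by ext m; simp [hx0])
    refine mem_iUnion.2 ⟨k, hxU, fun j hj ↦ ?_, hk ▸ Nat.find_spec hex⟩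
    exact not_not.1 (Nat.find_min hex (by omega))
  refine measure_mono_null hcover (measure_iUnion_null fun k ↦ ?_)
  refine measure_null_of_locally_null _ fun x hx ↦ ?_
  obtain ⟨hxU, hx0, hx1⟩ := hx
  have han : AnalyticAt ℝ (iteratedFDeriv ℝ k f) x := hf.iteratedFDeriv k x hxU
  obtain ⟨m, hm⟩ : ∃ m, iteratedFDeriv ℝ (k + 1) f x m ≠ 0 := by
    by_contra! hcon
    exact hx1 (ContinuousMultilinearMap.ext hcon)
  set ev := ContinuousMultilinearMap.apply ℝ (fun _ : Fin k ↦ V) ℝ (Fin.tail m)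
  -- A directional derivative of order `k` vanishes on all of `C k`, and the choice of `m` makes its
  -- differential at `x` nonzero on `m 0`.
  set g : V → ℝ := fun y ↦ iteratedFDeriv ℝ k f y (Fin.tail m)
  have hg : AnalyticAt ℝ g x := (ev.analyticAt _).comp han
  have hgd : fderiv ℝ g x (m 0) = iteratedFDeriv ℝ (k + 1) f x m := by
    rw [iteratedFDeriv_succ_apply_left]
    have : HasFDerivAt g (ev ∘L fderiv ℝ (iteratedFDeriv ℝ k f) x) x :=
      ev.hasFDerivAt.comp x han.differentiableAt.hasFDerivAt
    rw [this.fderiv]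
    rfl
  obtain ⟨u, hu, hμ⟩ := h x hxU g hg (by simp [g, hx0 k le_rfl]) fun h0 ↦ hm (by
    rw [← hgd, h0]; rfl)
  refine ⟨u ∩ C k, inter_mem (mem_nhdsWithin_of_mem_nhds hu) self_mem_nhdsWithin,
    measure_mono_null ?_ hμ⟩
  rintro y ⟨hyu, hyU, hy0, -⟩
  refine ⟨hyu, ?_, by simp [g, hy0 k le_rfl]⟩
  have := hy0 0 (Nat.zero_le _)
  simpa using congrArg (fun F ↦ F 0) this

variable [FiniteDimensional ℝ V] [MeasurableSpace V] [BorelSpace V] (μ : Measure V)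
  [μ.IsAddHaarMeasure]

/-- The zero set of a function is negligible where the derivative does not vanish. -/
theorem addHaar_zeros_of_fderiv_ne_zero {g : V → ℝ} {s : Set V} (h0 : ∀ x ∈ s, g x = 0)
    (hd : ∀ x ∈ s, DifferentiableAt ℝ g x) (h1 : ∀ x ∈ s, fderiv ℝ g x ≠ 0) : μ s = 0 := by
  have hv : ∀ x, ∃ v : V, x ∈ s → fderiv ℝ g x v = -1 := by
    intro x
    by_cases hx : x ∈ s
    · obtain ⟨w, hw⟩ : ∃ w, fderiv ℝ g x w ≠ 0 := by
        by_contra! hcon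
        exact h1 x hx (ContinuousLinearMap.ext hcon)
      exact ⟨-(fderiv ℝ g x w)⁻¹ • w, fun _ ↦ by simp [hw]⟩
    · exact ⟨0, fun h ↦ absurd h hx⟩
  choose v hv using hv
  -- On `s` the identity agrees with `y ↦ y + g y • v x`, so `id + dg ⊗ v x` is a derivative of the
  -- identity within `s`. It kills `v x` because `dg (v x) = -1`; thus `s` is the image of a map
  -- with singular derivatives, hence null.
  rw [← image_id s]
  refine addHaar_image_eq_zero_of_det_fderivWithin_eq_zero μ
    (f' := fun x ↦ ContinuousLinearMap.id ℝ V + (fderiv ℝ g x).smulRight (v x)) ?_ ?_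
  · intro x hx
    have hg : HasFDerivWithinAt (fun y ↦ g y • v x) ((fderiv ℝ g x).smulRight (v x)) s x :=
      ((hd x hx).hasFDerivAt.smul_const (v x)).hasFDerivWithinAt
    refine ((hasFDerivWithinAt_id x s).add hg).congr (fun y hy ↦ ?_) ?_
    · simp [h0 y hy]
    · simp [h0 x hx]
  · intro x hx
    by_contra hdet
    have hinj : Function.Injective (ContinuousLinearMap.id ℝ V
        + (fderiv ℝ g x).smulRight (v x)) := by
      have := LinearMap.equivOfDetNeZero _ hdet
      exact (LinearMap.equivOfDetNeZero _ hdet).injective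
    have : v x = 0 := hinj (by simp [hv x hx])
    have h2 := hv x hx
    rw [this] at h2
    simp at h2

/-- The zero set of an analytic function which does not vanish identically is negligible. -/
theorem addHaar_zeros_of_analyticOnNhd {f : V → ℝ} {U : Set V}
    (hc : IsPreconnected U) (hf : AnalyticOnNhd ℝ f U) (hne : ∃ x ∈ U, f x ≠ 0) :
    μ {x ∈ U | f x = 0} = 0 := by
  obtain ⟨z, hz, hfz⟩ := hne
  refine outerMeasure_zeros_eq_zero μ.toOuterMeasure hf (fun x hx hcon ↦ ?_) ?_
  · exact hfz (hf.eqOn_zero_of_preconnected_of_eventuallyEq_zero hc hx hcon hz)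
  · intro x hx g hg _ hg1
    have hc1 : ∀ᶠ y in 𝓝 x, fderiv ℝ g y ≠ 0 := hg.fderiv.continuousAt.eventually_ne hg1
    refine ⟨{y | AnalyticAt ℝ g y ∧ fderiv ℝ g y ≠ 0}, hg.eventually_analyticAt.and hc1, ?_⟩
    exact addHaar_zeros_of_fderiv_ne_zero μ (g := g) (fun y hy ↦ hy.2.2)
      (fun y hy ↦ hy.1.1.differentiableAt) (fun y hy ↦ hy.1.2)

end ZeroSets

/-! ### Critical hypersurfaces detected by the measure of an image. -/

section Hypersurface

open Set Filter Topology MeasureTheory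

variable {V W : Type*} [NormedAddCommGroup V] [NormedSpace ℝ V] [FiniteDimensional ℝ V]
  [NormedAddCommGroup W] [NormedSpace ℝ W] [FiniteDimensional ℝ W]

theorem exists_continuousLinearEquiv_prod_eq {A : V →L[ℝ] W} {ℓ : V →L[ℝ] ℝ}
    (hdim : Module.finrank ℝ V = Module.finrank ℝ W + 1)
    (hA : ∀ v, ℓ v = 0 → A v = 0 → v = 0) :
    ∃ e : V ≃L[ℝ] W × ℝ, (e : V →L[ℝ] W × ℝ) = A.prod ℓ := by
  have hinj : Function.Injective (A.prod ℓ : V →ₗ[ℝ] W × ℝ) := by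
    refine (injective_iff_map_eq_zero _).2 fun v hv ↦ ?_
    have h1 : A v = 0 := congrArg Prod.fst hv
    have h2 : ℓ v = 0 := congrArg Prod.snd hv
    exact hA v h2 h1
  refine ⟨(LinearMap.linearEquivOfInjective _ hinj (by simp [hdim])).toContinuousLinearEquiv, ?_⟩
  ext v <;> rfl

/-- Compose a projection onto the kernel of `ℓ` with an isomorphism from that kernel to `W`. -/
theorem exists_complement_of_functional {ℓ : V →L[ℝ] ℝ}
    (hdim : Module.finrank ℝ V = Module.finrank ℝ W + 1) (hℓ : ℓ ≠ 0) :
    ∃ A : V →L[ℝ] W, ∀ v, ℓ v = 0 → A v = 0 → v = 0 := by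
  obtain ⟨w, hw⟩ : ∃ w, ℓ w ≠ 0 := by
    by_contra! hcon
    exact hℓ (ContinuousLinearMap.ext hcon)
  have hsurj : Function.Surjective (ℓ : V →ₗ[ℝ] ℝ) := fun t ↦
    ⟨(t / ℓ w) • w, by simp [hw]⟩
  have hker : Module.finrank ℝ (LinearMap.ker (ℓ : V →ₗ[ℝ] ℝ)) = Module.finrank ℝ W := by
    have h1 := LinearMap.finrank_range_add_finrank_ker (ℓ : V →ₗ[ℝ] ℝ)
    rw [LinearMap.range_eq_top.2 hsurj] at h1
    simp at h1
    omega
  set k := LinearEquiv.ofFinrankEq _ _ hker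
  obtain ⟨P, hP⟩ := (LinearMap.ker (ℓ : V →ₗ[ℝ] ℝ)).subtype.exists_leftInverse_of_injective
    (by simp)
  refine ⟨((k : _ →ₗ[ℝ] W) ∘ₗ P).toContinuousLinearMap, fun v hv hv' ↦ ?_⟩
  have hv' : k (P v) = 0 := hv'
  have h2 : P v = ⟨v, hv⟩ := LinearMap.congr_fun hP (⟨v, hv⟩ : LinearMap.ker (ℓ : V →ₗ[ℝ] ℝ))
  rw [LinearEquiv.map_eq_zero_iff, h2] at hv'
  exact congrArg Subtype.val hv'

/-- The inverse function theorem for analytic maps. -/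
theorem AnalyticAt.exists_localInverse {V' : Type*} [NormedAddCommGroup V'] [NormedSpace ℝ V']
    {f : V → V'} {x : V} (hf : AnalyticAt ℝ f x) (e : V ≃L[ℝ] V')
    (he : (e : V →L[ℝ] V') = fderiv ℝ f x) :
    ∃ R : OpenPartialHomeomorph V V', x ∈ R.source ∧ (∀ y, R y = f y) ∧
      AnalyticAt ℝ R.symm (f x) := by
  have hs : HasStrictFDerivAt f (e : V →L[ℝ] V') x := he ▸ hf.hasStrictFDerivAt
  refine ⟨hs.toOpenPartialHomeomorph f, hs.mem_toOpenPartialHomeomorph_source, fun y ↦ rfl, ?_⟩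
  exact (hs.toOpenPartialHomeomorph f).analyticAt_symm' (i := e)
    hs.mem_toOpenPartialHomeomorph_source hf he.symm

/-- If a differentiable map to a space of one dimension less sends the zero set of an analytic
function to a set of positive measure, then this zero set contains a piece of analytic hypersurface
on which the map is immersive at some point. -/
theorem exists_hypersurface_of_image_zeros_ne_zero [MeasurableSpace W] [BorelSpace W]
    (μ : Measure W) [μ.IsAddHaarMeasure]
    (hdim : Module.finrank ℝ V = Module.finrank ℝ W + 1) {f : V → ℝ} {Θ : V → W} {U : Set V}
    (hU : IsOpen U) (hf : AnalyticOnNhd ℝ f U) (hne : ∀ x ∈ U, ¬ ∀ᶠ y in 𝓝 x, f y = 0)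
    (hΘ : DifferentiableOn ℝ Θ U) (hμ : μ (Θ '' {x ∈ U | f x = 0}) ≠ 0) :
    ∃ x ∈ U, ∃ p : V → ℝ, AnalyticAt ℝ p x ∧ p x = 0 ∧ fderiv ℝ p x ≠ 0 ∧
      (∀ᶠ y in 𝓝 x, p y = 0 → f y = 0) ∧
      ∀ v, fderiv ℝ p x v = 0 → fderiv ℝ Θ x v = 0 → v = 0 := by
  by_contra! hcon
  apply hμ
  -- The set function `s ↦ μ (Θ '' s)` is only an outer measure, which is why the covering lemma is
  -- stated for those.
  have key := outerMeasure_zeros_eq_zero (OuterMeasure.comap Θ μ.toOuterMeasure) hf hne ?_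
  · simpa using key
  intro x hx g hg hg0 hg1
  obtain ⟨A, hA⟩ := exists_complement_of_functional hdim hg1
  obtain ⟨e, he⟩ := exists_continuousLinearEquiv_prod_eq hdim hA
  -- In the coordinates `(A, g)` the hypersurface `g = 0` is the slice `W × {0}`, parametrized by
  -- `ι` below.
  set Ψ : V → W × ℝ := fun y ↦ (A y, g y)
  have hΨdef : ∀ y, Ψ y = (A y, g y) := fun _ ↦ rfl
  have hΨ : ∀ y, AnalyticAt ℝ g y → AnalyticAt ℝ Ψ y := fun y hy ↦ (A.analyticAt y).prod hy
  have hΨ' : ∀ y, AnalyticAt ℝ g y → HasFDerivAt Ψ (A.prod (fderiv ℝ g y)) y := fun y hy ↦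
    A.hasFDerivAt.prodMk hy.differentiableAt.hasFDerivAt
  obtain ⟨R, hxR, hR, hRs⟩ := (hΨ x hg).exists_localInverse e (by rw [he, (hΨ' x hg).fderiv])
  have hx1 : R.symm (A x, 0) = x := by
    have := R.left_inv hxR
    rwa [hR, hΨdef, hg0] at this
  have hRs : AnalyticAt ℝ R.symm (A x, 0) := by simpa [hΨdef, hg0] using hRs
  have ht : (A x, (0 : ℝ)) ∈ R.target := by
    have := R.map_source hxR
    rwa [hR, hΨdef, hg0] at this
  have hcont : ContinuousAt (fun w : W ↦ (w, (0 : ℝ))) (A x) := by fun_prop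
  have hgood : ∀ᶠ z in 𝓝 (A x, (0 : ℝ)), z ∈ R.target ∧ AnalyticAt ℝ R.symm z ∧
      R.symm z ∈ U ∧ AnalyticAt ℝ g (R.symm z) ∧ fderiv ℝ g (R.symm z) ≠ 0 := by
    have hc := hRs.continuousAt
    rw [ContinuousAt, hx1] at hc
    refine (R.open_target.eventually_mem ht).and (hRs.eventually_analyticAt.and
      ((hc.eventually (hU.mem_nhds hx)).and ((hc.eventually hg.eventually_analyticAt).and
      (hc.eventually (hg.fderiv.continuousAt.eventually_ne hg1)))))
  obtain ⟨ε, hε, hB⟩ := Metric.eventually_nhds_iff_ball.1 (hcont.eventually hgood)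
  set ι : W → V := fun w ↦ R.symm (w, 0)
  have hι : ∀ w ∈ Metric.ball (A x) ε, AnalyticAt ℝ ι w := fun w hw ↦
    AnalyticAt.fun_comp (g := R.symm) (f := fun w : W ↦ (w, (0 : ℝ))) (hB w hw).2.1
      (analyticAt_id.prod analyticAt_const)
  have hinv : ∀ y ∈ R.source, g y = 0 → ι (A y) = y := by
    intro y hy hgy
    have := R.left_inv hy
    rwa [hR, hΨdef, hgy] at this
  have hgι : ∀ w ∈ Metric.ball (A x) ε, A (ι w) = w ∧ g (ι w) = 0 := by
    intro w hw
    have := R.right_inv (hB w hw).1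
    rw [hR] at this
    exact ⟨congrArg Prod.fst this, congrArg Prod.snd this⟩
  have hΘι : ∀ w ∈ Metric.ball (A x) ε,
      HasFDerivAt (Θ ∘ ι) (fderiv ℝ Θ (ι w) ∘L fderiv ℝ ι w) w := fun w hw ↦
    (((hΘ _ (hB w hw).2.2.1).differentiableAt (hU.mem_nhds (hB w hw).2.2.1)).hasFDerivAt).comp w
      (hι w hw).differentiableAt.hasFDerivAt
  refine ⟨R.source ∩ A ⁻¹' Metric.ball (A x) ε, inter_mem (R.open_source.mem_nhds hxR)
    (A.continuous.continuousAt.preimage_mem_nhds (Metric.ball_mem_nhds _ hε)), ?_⟩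
  rw [OuterMeasure.comap_apply]
  have hsub : Θ '' {y ∈ R.source ∩ A ⁻¹' Metric.ball (A x) ε | f y = 0 ∧ g y = 0} ⊆
      (Θ ∘ ι) '' {w ∈ Metric.ball (A x) ε | f (ι w) = 0} := by
    rintro _ ⟨y, ⟨⟨hyR, hyB⟩, hfy, hgy⟩, rfl⟩
    exact ⟨A y, ⟨hyB, by rw [hinv y hyR hgy, hfy]⟩, by simp [hinv y hyR hgy]⟩
  refine measure_mono_null hsub ?_
  -- Either `f` is not identically zero on the piece of hypersurface, and its zeros there are null
  -- with null image; or it is, and since `Θ` is nowhere immersive along the piece, Sard's lemma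
  -- applies to `Θ ∘ ι`.
  by_cases hz : ∃ w ∈ Metric.ball (A x) ε, f (ι w) ≠ 0
  · refine addHaar_image_eq_zero_of_differentiableOn_of_addHaar_eq_zero μ
      (fun w hw ↦ (hΘι w hw.1).differentiableAt.differentiableWithinAt) ?_
    exact addHaar_zeros_of_analyticOnNhd μ (convex_ball _ _).isPreconnected
      (fun w hw ↦ AnalyticAt.fun_comp (f := ι) (hf _ (hB w hw).2.2.1) (hι w hw)) hz
  · push Not at hz
    refine addHaar_image_eq_zero_of_det_fderivWithin_eq_zero μ
      (fun w hw ↦ (hΘι w hw.1).hasFDerivWithinAt) fun w hw ↦ ?_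
    obtain ⟨ht, hψw, hUw, hgw, hg1w⟩ := hB w hw.1
    have hsrc : ι w ∈ R.source := R.map_target ht
    have hopen : IsOpen (R.source ∩ A ⁻¹' Metric.ball (A x) ε) :=
      R.open_source.inter (Metric.isOpen_ball.preimage A.continuous)
    have hmem : ι w ∈ R.source ∩ A ⁻¹' Metric.ball (A x) ε :=
      ⟨hsrc, by simpa only [mem_preimage, (hgι w hw.1).1] using hw.1⟩
    obtain ⟨v, hv1, hv2, hv3⟩ := hcon (ι w) hUw g hgw (hgι w hw.1).2 hg1w (by
      filter_upwards [hopen.mem_nhds hmem] with y hy hgy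
      have := hz (A y) hy.2
      rwa [hinv y hy.1 hgy] at this)
    -- The derivative of `ι` inverts `A` on vectors tangent to `g = 0`, so a tangent kernel vector
    -- `v` of `dΘ` yields the kernel vector `A v` of `d(Θ ∘ ι)`.
    have hιd : fderiv ℝ ι w (A v) = v := by
      have h1 : HasFDerivAt (R.symm ∘ Ψ)
          (fderiv ℝ R.symm (w, 0) ∘L A.prod (fderiv ℝ g (ι w))) (ι w) := by
        refine HasFDerivAt.comp (ι w) ?_ (hΨ' _ hgw)
        have : Ψ (ι w) = (w, 0) := Prod.ext (hgι w hw.1).1 (hgι w hw.1).2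
        rw [this]
        exact hψw.differentiableAt.hasFDerivAt
      have h2 : HasFDerivAt (R.symm ∘ Ψ) (ContinuousLinearMap.id ℝ V) (ι w) := by
        refine (hasFDerivAt_id _).congr_of_eventuallyEq ?_
        filter_upwards [R.open_source.mem_nhds hsrc] with y hy
        have := R.left_inv hy
        rwa [hR] at this
      have h3 : HasFDerivAt ι (fderiv ℝ R.symm (w, 0) ∘L ContinuousLinearMap.inl ℝ W ℝ) w := by
        refine HasFDerivAt.comp w hψw.differentiableAt.hasFDerivAt ?_
        exact (hasFDerivAt_id w).prodMk (hasFDerivAt_const (0 : ℝ) w)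
      have h4 := congrArg (fun L ↦ L v) (h1.unique h2)
      rw [h3.fderiv]
      simpa [hv1] using h4
    by_contra hdet
    have hinj := (LinearMap.equivOfDetNeZero _ hdet).injective
    have h0 : A v = 0 := hinj (by
      change (fderiv ℝ Θ (ι w) ∘L fderiv ℝ ι w) (A v) = (fderiv ℝ Θ (ι w) ∘L fderiv ℝ ι w) 0
      simp [hιd, hv2])
    rw [h0, map_zero] at hιd
    exact hv3 hιd.symm

end Hypersurface

/-! ### Unique continuation by orders of vanishing. -/

section UniqueContinuation

open Set Filter Topology Asymptotics

variable {V W : Type*} [NormedAddCommGroup V] [NormedSpace ℝ V]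
  [NormedAddCommGroup W] [NormedSpace ℝ W]

/-- If the order were `m < k`, the leading factor would be `O(t ^ (k - m))` away from `0`, so it
would vanish at `0`. -/
theorem AnalyticAt.le_analyticOrderAt_of_isBigO {f : ℝ → V} (hf : AnalyticAt ℝ f 0) {k : ℕ}
    (h : f =O[𝓝 0] fun t : ℝ ↦ t ^ k) : (k : ℕ∞) ≤ analyticOrderAt f 0 := by
  by_contra! hlt
  obtain ⟨m, hm⟩ := ENat.ne_top_iff_exists.1 (ne_top_of_lt hlt)
  rw [← hm] at hlt
  have hmk : m < k := by exact_mod_cast hlt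
  obtain ⟨g, hg, hg0, hfg⟩ := hf.analyticOrderAt_eq_natCast.1 hm.symm
  obtain ⟨C, hC⟩ := h.bound
  have hlim : Tendsto g (𝓝[≠] 0) (𝓝 0) := by
    have hz : Tendsto (fun t : ℝ ↦ C * |t| ^ (k - m)) (𝓝[≠] 0) (𝓝 0) := by
      have : ContinuousAt (fun t : ℝ ↦ C * |t| ^ (k - m)) 0 := by fun_prop
      have h2 := this.tendsto.mono_left (nhdsWithin_le_nhds (s := {0}ᶜ))
      simpa [Nat.sub_ne_zero_of_lt hmk] using h2
    refine squeeze_zero_norm' ?_ hz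
    filter_upwards [self_mem_nhdsWithin, hfg.filter_mono nhdsWithin_le_nhds,
      hC.filter_mono nhdsWithin_le_nhds] with t ht h1 h2
    have ht' : 0 < |t| ^ m := pow_pos (abs_pos.2 ht) m
    rw [h1, sub_zero, norm_smul, norm_pow, norm_pow, Real.norm_eq_abs] at h2
    have h3 : |t| ^ k = |t| ^ m * |t| ^ (k - m) := by
      rw [← pow_add, Nat.add_sub_of_le hmk.le]
    rw [h3] at h2
    refine le_of_mul_le_mul_left ?_ ht'
    linarith
  exact hg0 (tendsto_nhds_unique (hg.continuousAt.tendsto.mono_left nhdsWithin_le_nhds) hlim)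

theorem iteratedDeriv_eventuallyEq_of_hasDerivAt_chain {u : ℕ → ℝ → V}
    (hd : ∀ j, ∀ᶠ t in 𝓝 0, HasDerivAt (u j) (u (j + 1) t) t) (j : ℕ) :
    iteratedDeriv j (u 0) =ᶠ[𝓝 0] u j := by
  induction j with
  | zero => simp
  | succ j ih =>
    rw [iteratedDeriv_succ]
    refine ih.deriv.trans ?_
    filter_upwards [hd j] with t ht using ht.deriv

variable [CompleteSpace V]

/-- Stated for an abstract chain of derivatives so as to serve both `∂_t^j H` and the
`y`-differentials of `∂_t^j H`. -/
theorem isBigO_pow_of_hasDerivAt_chain {u : ℕ → ℝ → V} (hu : AnalyticAt ℝ (u 0) 0)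
    (hd : ∀ j, ∀ᶠ t in 𝓝 0, HasDerivAt (u j) (u (j + 1) t) t) {k : ℕ}
    (h0 : ∀ j < k, u j 0 = 0) :
    (k : ℕ∞) ≤ analyticOrderAt (u 0) 0 ∧ u 0 =O[𝓝 0] fun t : ℝ ↦ t ^ k := by
  have hit := iteratedDeriv_eventuallyEq_of_hasDerivAt_chain hd
  have hk : (k : ℕ∞) ≤ analyticOrderAt (u 0) 0 := by
    rw [natCast_le_analyticOrderAt_iff_iteratedDeriv_eq_zero hu]
    intro j hj
    rw [(hit j).self_of_nhds, h0 j hj]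
  refine ⟨hk, ?_⟩
  obtain ⟨g, hg, hfg⟩ := (natCast_le_analyticOrderAt hu).1 hk
  have hg1 : g =O[𝓝 0] fun _ ↦ (1 : ℝ) := hg.continuousAt.isBigO_one ℝ
  have h2 : (fun t : ℝ ↦ (t - 0) ^ k • g t) =O[𝓝 0] fun t : ℝ ↦ t ^ k • (1 : ℝ) :=
    (isBigO_refl (fun t : ℝ ↦ t ^ k) _).smul hg1 |>.congr_left (by simp)
  exact (h2.congr' (hfg.mono fun t ht ↦ ht.symm) (by simp))

/-- The iterated partial derivatives of a function on `W × ℝ` in the last variable. -/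
noncomputable def iteratedLastDeriv (H : W × ℝ → V) : ℕ → W × ℝ → V
  | 0 => H
  | j + 1 => fun z ↦ fderiv ℝ (iteratedLastDeriv H j) z (0, 1)

theorem analyticAt_iteratedLastDeriv {H : W × ℝ → V} {z : W × ℝ} (hH : AnalyticAt ℝ H z) (j : ℕ) :
    AnalyticAt ℝ (iteratedLastDeriv H j) z := by
  induction j with
  | zero => exact hH
  | succ j ih =>
    exact ((ContinuousLinearMap.apply ℝ V ((0 : W), (1 : ℝ))).analyticAt _).comp ih.fderiv

theorem hasDerivAt_iteratedLastDeriv {H : W × ℝ → V} {y : W} {t : ℝ}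
    (hH : AnalyticAt ℝ H (y, t)) (j : ℕ) :
    HasDerivAt (fun s ↦ iteratedLastDeriv H j (y, s)) (iteratedLastDeriv H (j + 1) (y, t)) t := by
  have h1 : HasDerivAt (fun s : ℝ ↦ (y, s)) ((0 : W), (1 : ℝ)) t :=
    (hasDerivAt_const t y).prodMk (hasDerivAt_id t)
  exact (analyticAt_iteratedLastDeriv hH j).differentiableAt.hasFDerivAt.comp_hasDerivAt t h1

/-- Symmetry of second derivatives: `∂_t` commutes with the `y`-differential. -/
theorem hasDerivAt_fderiv_iteratedLastDeriv {H : W × ℝ → V} {y : W} {t : ℝ}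
    (hH : AnalyticAt ℝ H (y, t)) (j : ℕ) :
    HasDerivAt
      (fun s ↦ fderiv ℝ (iteratedLastDeriv H j) (y, s) ∘L ContinuousLinearMap.inl ℝ W ℝ)
      (fderiv ℝ (iteratedLastDeriv H (j + 1)) (y, t) ∘L ContinuousLinearMap.inl ℝ W ℝ) t := by
  have han := analyticAt_iteratedLastDeriv hH j
  have h1 : HasDerivAt (fun s : ℝ ↦ (y, s)) ((0 : W), (1 : ℝ)) t :=
    (hasDerivAt_const t y).prodMk (hasDerivAt_id t)
  have h2 := han.fderiv.differentiableAt.hasFDerivAt.comp_hasDerivAt t h1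
  have h3 := h2.clm_comp (hasDerivAt_const t (ContinuousLinearMap.inl ℝ W ℝ))
  refine h3.congr_deriv ?_
  have h4 : HasFDerivAt (iteratedLastDeriv H (j + 1))
      ((fderiv ℝ (fderiv ℝ (iteratedLastDeriv H j)) (y, t)).flip (0, 1)) (y, t) := by
    have := han.fderiv.differentiableAt.hasFDerivAt.clm_apply
      (hasFDerivAt_const ((0 : W), (1 : ℝ)) (y, t))
    rw [ContinuousLinearMap.comp_zero, zero_add] at this
    exact this
  have hsymm : IsSymmSndFDerivAt ℝ (iteratedLastDeriv H j) (y, t) :=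
    (han.contDiffAt (n := ω)).isSymmSndFDerivAt (by simp)
  rw [h4.fderiv]
  ext w
  simpa using hsymm ((0 : W), (1 : ℝ)) (w, 0)

/-- Unique continuation across an analytic hypersurface: an analytic function that vanishes on
`t = 0` and whose derivative in `t` is controlled by the function and its other derivatives
vanishes identically. -/
theorem AnalyticAt.eventually_eq_zero_of_norm_lastDeriv_le {H : W × ℝ → V} {y₀ : W}
    (hH : AnalyticAt ℝ H (y₀, 0)) (h0 : ∀ᶠ z in 𝓝 (y₀, (0 : ℝ)), z.2 = 0 → H z = 0) {C : ℝ}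
    (hC : ∀ᶠ z in 𝓝 (y₀, (0 : ℝ)), ‖fderiv ℝ H z (0, 1)‖ ≤
      C * (‖H z‖ + ‖fderiv ℝ H z ∘L ContinuousLinearMap.inl ℝ W ℝ‖)) :
    ∀ᶠ z in 𝓝 (y₀, (0 : ℝ)), H z = 0 := by
  obtain ⟨ε, hε, hB⟩ := Metric.eventually_nhds_iff_ball.1
    (hH.eventually_analyticAt.and (h0.and hC))
  have hmem : ∀ {y : W} {t : ℝ}, y ∈ Metric.ball y₀ ε → t ∈ Metric.ball (0 : ℝ) ε →
      (y, t) ∈ Metric.ball (y₀, (0 : ℝ)) ε := fun hy ht ↦ by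
    rw [← ball_prod_same]; exact ⟨hy, ht⟩
  have hzero : (0 : ℝ) ∈ Metric.ball (0 : ℝ) ε := Metric.mem_ball_self hε
  have hcurve : ∀ {y : W} {t : ℝ}, AnalyticAt ℝ (fun s : ℝ ↦ (y, s)) t := fun {y t} ↦
    analyticAt_const.prod analyticAt_id
  have hu : ∀ y ∈ Metric.ball y₀ ε, ∀ t ∈ Metric.ball (0 : ℝ) ε, ∀ j,
      AnalyticAt ℝ (fun s ↦ iteratedLastDeriv H j (y, s)) t := fun y hy t ht j ↦
    AnalyticAt.fun_comp (f := fun s : ℝ ↦ (y, s)) (analyticAt_iteratedLastDeriv (hB _ (hmem hy ht)).1 j) hcurve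
  have hev : ∀ᶠ t in 𝓝 (0 : ℝ), t ∈ Metric.ball (0 : ℝ) ε := Metric.ball_mem_nhds _ hε
  -- Bootstrap on the order in `t`, uniformly in `y`: if `H = O(t^k)` for all `y`, then also `∂_y H
  -- = O(t^k)`, the inequality gives `∂_t H = O(t^k)`, and integrating from `H (y, 0) = 0` gains one
  -- order.
  have key : ∀ k, ∀ y ∈ Metric.ball y₀ ε, ∀ j < k, iteratedLastDeriv H j (y, 0) = 0 := by
    intro k
    induction k with
    | zero => simp
    | succ k ih =>
      intro y hy j hj
      rcases Nat.lt_succ_iff_lt_or_eq.1 hj with hj | rfl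
      · exact ih y hy j hj
      rcases Nat.eq_zero_or_pos j with rfl | hjpos
      · exact (hB _ (hmem hy hzero)).2.1 rfl
      have h1 := isBigO_pow_of_hasDerivAt_chain (u := fun j s ↦ iteratedLastDeriv H j (y, s))
        (hu y hy 0 hzero 0)
        (fun i ↦ hev.mono fun t ht ↦ hasDerivAt_iteratedLastDeriv (hB _ (hmem hy ht)).1 i) (ih y hy)
      have h2 := isBigO_pow_of_hasDerivAt_chain
        (u := fun j s ↦ fderiv ℝ (iteratedLastDeriv H j) (y, s) ∘L ContinuousLinearMap.inl ℝ W ℝ)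
        (k := j) ?_ (fun i ↦ hev.mono fun t ht ↦
          hasDerivAt_fderiv_iteratedLastDeriv (hB _ (hmem hy ht)).1 i) ?_
      · have h3 : (fun s ↦ iteratedLastDeriv H 1 (y, s)) =O[𝓝 0] fun t : ℝ ↦ t ^ j := by
          refine IsBigO.trans (g := fun s ↦ ‖iteratedLastDeriv H 0 (y, s)‖ +
            ‖fderiv ℝ (iteratedLastDeriv H 0) (y, s) ∘L ContinuousLinearMap.inl ℝ W ℝ‖) ?_
            (h1.2.norm_left.add h2.2.norm_left)
          refine IsBigO.of_bound C (hev.mono fun t ht ↦ ?_)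
          rw [Real.norm_of_nonneg (by positivity)]
          exact (hB _ (hmem hy ht)).2.2
        have h4 := (hu y hy 0 hzero 1).le_analyticOrderAt_of_isBigO h3
        have h5 : deriv (fun s ↦ iteratedLastDeriv H 0 (y, s)) =ᶠ[𝓝 0]
            fun s ↦ iteratedLastDeriv H 1 (y, s) :=
          hev.mono fun t ht ↦ (hasDerivAt_iteratedLastDeriv (hB _ (hmem hy ht)).1 0).deriv
        have h6 := (hu y hy 0 hzero 0).analyticOrderAt_deriv_add_one
        rw [analyticOrderAt_congr h5] at h6
        have h7 : iteratedLastDeriv H 0 (y, 0) = 0 := ih y hy 0 hjpos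
        simp only [h7, sub_zero] at h6
        have h8 : ((j + 1 : ℕ) : ℕ∞) ≤
            analyticOrderAt (fun s ↦ iteratedLastDeriv H 0 (y, s)) 0 := by
          rw [← h6]; push_cast; gcongr
        rw [natCast_le_analyticOrderAt_iff_iteratedDeriv_eq_zero (hu y hy 0 hzero 0)] at h8
        have h9 := iteratedDeriv_eventuallyEq_of_hasDerivAt_chain
          (u := fun j s ↦ iteratedLastDeriv H j (y, s))
          fun i ↦ hev.mono fun t ht ↦ hasDerivAt_iteratedLastDeriv (hB _ (hmem hy ht)).1 i
        exact (h9 j).self_of_nhds.symm.trans (h8 j (Nat.lt_succ_self j))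
      · refine AnalyticAt.fun_comp (f := fun s : ℝ ↦ (y, s))
          (g := fun z ↦ fderiv ℝ (iteratedLastDeriv H 0) z ∘L ContinuousLinearMap.inl ℝ W ℝ) ?_ hcurve
        exact ((ContinuousLinearMap.compL ℝ W (W × ℝ) V).flip
          (ContinuousLinearMap.inl ℝ W ℝ)).analyticAt _ |>.comp
          (analyticAt_iteratedLastDeriv (hB _ (hmem hy hzero)).1 0).fderiv
      -- The induction hypothesis holds on an open set of `y`, so it can be differentiated in `y`.
      · intro i hi
        have hd : HasFDerivAt (fun w : W ↦ iteratedLastDeriv H i (w, 0))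
            (fderiv ℝ (iteratedLastDeriv H i) (y, 0) ∘L ContinuousLinearMap.inl ℝ W ℝ) y :=
          (analyticAt_iteratedLastDeriv (hB _ (hmem hy hzero)).1 i).differentiableAt.hasFDerivAt.comp y
            ((hasFDerivAt_id y).prodMk (hasFDerivAt_const (0 : ℝ) y))
        refine hd.unique ((hasFDerivAt_const (0 : V) y).congr_of_eventuallyEq ?_)
        filter_upwards [Metric.isOpen_ball.mem_nhds hy] with w hw using ih w hw i hi
  refine Filter.mem_of_superset (Metric.ball_mem_nhds _ hε) fun z hz ↦ ?_
  obtain ⟨y, t⟩ := z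
  rw [← ball_prod_same] at hz
  obtain ⟨hy, ht⟩ := hz
  have htop : analyticOrderAt (fun s ↦ iteratedLastDeriv H 0 (y, s)) 0 = ⊤ :=
    ENat.eq_top_iff_forall_ge.2 fun k ↦
      (isBigO_pow_of_hasDerivAt_chain (u := fun j s ↦ iteratedLastDeriv H j (y, s))
        (hu y hy 0 hzero 0)
        (fun i ↦ hev.mono fun t ht ↦ hasDerivAt_iteratedLastDeriv (hB _ (hmem hy ht)).1 i)
        (key k y hy)).1
  have hA : AnalyticOnNhd ℝ (fun s ↦ iteratedLastDeriv H 0 (y, s)) (Metric.ball (0 : ℝ) ε) :=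
    fun t ht ↦ hu y hy t ht 0
  exact hA.eqOn_zero_of_preconnected_of_eventuallyEq_zero (convex_ball _ _).isPreconnected hzero
    (analyticOrderAt_eq_top.1 htop) ht

end UniqueContinuation

/-! ### Projectable vector fields transverse to a critical hypersurface. -/

section RelatedFields

open Set Filter Topology

variable {V W : Type*} [NormedAddCommGroup V] [NormedSpace ℝ V] [FiniteDimensional ℝ V]
  [NormedAddCommGroup W] [NormedSpace ℝ W] [FiniteDimensional ℝ W]

/-- Let `φ` be an analytic map between spaces of the same dimension which is singular along an
analytic hypersurface `p = 0` and immersive on it. If a continuous vector field `ξ` transverse to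
the hypersurface is `φ`-related to a `C¹` vector field `Ξ`, then `φ` is singular everywhere. -/
theorem not_injective_fderiv_of_related {φ : V → V} {p : V → ℝ} {x₀ : V} {A : V →L[ℝ] W}
    {ξ Ξ : V → V} (hdim : Module.finrank ℝ V = Module.finrank ℝ W + 1)
    (hφ : AnalyticAt ℝ φ x₀) (hp : AnalyticAt ℝ p x₀) (hp0 : p x₀ = 0)
    (hA : ∀ v, fderiv ℝ p x₀ v = 0 → A (fderiv ℝ φ x₀ v) = 0 → v = 0)
    (hsing : ∀ᶠ x in 𝓝 x₀, p x = 0 → ¬ Function.Injective (fderiv ℝ φ x))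
    (hξ : ContinuousAt ξ x₀) (hΞ : ContDiffAt ℝ 1 Ξ (φ x₀))
    (hrel : ∀ᶠ x in 𝓝 x₀, fderiv ℝ φ x (ξ x) = Ξ (φ x)) (htr : fderiv ℝ p x₀ (ξ x₀) ≠ 0) :
    ∀ᶠ x in 𝓝 x₀, ¬ Function.Injective (fderiv ℝ φ x) := by
  obtain ⟨e, he⟩ := exists_continuousLinearEquiv_prod_eq (A := A ∘L fderiv ℝ φ x₀) hdim hA
  -- In the coordinates `(y, t) = (A ∘ φ, p)` the map `φ` becomes `F`, with `A (F (y, t)) = y`.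
  set Ψ : V → W × ℝ := fun y ↦ (A (φ y), p y)
  have hΨ' : ∀ y, AnalyticAt ℝ φ y → AnalyticAt ℝ p y →
      HasFDerivAt Ψ ((A ∘L fderiv ℝ φ y).prod (fderiv ℝ p y)) y := fun y hy hy' ↦
    (A.hasFDerivAt.comp y hy.differentiableAt.hasFDerivAt).prodMk
      hy'.differentiableAt.hasFDerivAt
  have hΨ : AnalyticAt ℝ Ψ x₀ := ((A.analyticAt _).comp hφ).prod hp
  obtain ⟨R, hxR, hR, hRs⟩ := hΨ.exists_localInverse e (by rw [he, (hΨ' x₀ hφ hp).fderiv])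
  have hΨx : Ψ x₀ = (A (φ x₀), 0) := Prod.ext rfl hp0
  set y₀ := A (φ x₀)
  set ψ : W × ℝ → V := ⇑R.symm
  have hψ0 : ψ (y₀, 0) = x₀ := by
    have := R.left_inv hxR
    rwa [hR, hΨx] at this
  have ht0 : (y₀, (0 : ℝ)) ∈ R.target := by
    have := R.map_source hxR
    rwa [hR, hΨx] at this
  rw [hΨx] at hRs
  have hψlim : Tendsto ψ (𝓝 (y₀, 0)) (𝓝 x₀) := by
    have := hRs.continuousAt.tendsto
    rwa [hψ0] at this
  set F : W × ℝ → V := fun z ↦ φ (ψ z)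
  have hF0 : AnalyticAt ℝ F (y₀, 0) := by
    refine AnalyticAt.fun_comp (f := ψ) ?_ hRs
    rwa [hψ0]
  set τ : W × ℝ → W × ℝ := fun z ↦ (z.1, 0)
  have hτ : ∀ z, AnalyticAt ℝ τ z := fun z ↦ analyticAt_fst.prod analyticAt_const
  have hτlim : Tendsto τ (𝓝 (y₀, 0)) (𝓝 (y₀, 0)) := (hτ (y₀, 0)).continuousAt.tendsto
  set Good : W × ℝ → Prop := fun z ↦ z ∈ R.target ∧ AnalyticAt ℝ ψ z ∧ AnalyticAt ℝ φ (ψ z) ∧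
    AnalyticAt ℝ p (ψ z) ∧ fderiv ℝ φ (ψ z) (ξ (ψ z)) = Ξ (φ (ψ z)) ∧
    (p (ψ z) = 0 → ¬ Function.Injective (fderiv ℝ φ (ψ z)))
  have hGood : ∀ᶠ z in 𝓝 (y₀, (0 : ℝ)), Good z :=
    (R.open_target.eventually_mem ht0).and (hRs.eventually_analyticAt.and
      ((hψlim.eventually hφ.eventually_analyticAt).and
      ((hψlim.eventually hp.eventually_analyticAt).and
      ((hψlim.eventually hrel).and (hψlim.eventually hsing)))))
  have hΨψ : ∀ z, Good z → ∀ v, A (fderiv ℝ φ (ψ z) (fderiv ℝ ψ z v)) = v.1 ∧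
      fderiv ℝ p (ψ z) (fderiv ℝ ψ z v) = v.2 := by
    rintro z ⟨hzt, hzψ, hzφ, hzp, -, -⟩ v
    have h1 := (hΨ' _ hzφ hzp).comp z hzψ.differentiableAt.hasFDerivAt
    have h2 : HasFDerivAt (Ψ ∘ ψ) (ContinuousLinearMap.id ℝ (W × ℝ)) z := by
      refine (hasFDerivAt_id z).congr_of_eventuallyEq ?_
      filter_upwards [R.open_target.mem_nhds hzt] with y hy
      have := R.right_inv hy
      rwa [hR] at this
    have h3 := congrArg (fun L ↦ L v) (h1.unique h2)
    exact ⟨congrArg Prod.fst h3, congrArg Prod.snd h3⟩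
  have hψΨ : ∀ z, Good z → ∀ v, fderiv ℝ ψ z (A (fderiv ℝ φ (ψ z) v), fderiv ℝ p (ψ z) v) = v := by
    rintro z ⟨hzt, hzψ, hzφ, hzp, -, -⟩ v
    have hz : Ψ (ψ z) = z := by
      have := R.right_inv hzt
      rwa [hR] at this
    have h1 : HasFDerivAt (ψ ∘ Ψ) _ (ψ z) := HasFDerivAt.comp (ψ z) (by
      rw [hz]; exact hzψ.differentiableAt.hasFDerivAt) (hΨ' _ hzφ hzp)
    have h2 : HasFDerivAt (ψ ∘ Ψ) (ContinuousLinearMap.id ℝ V) (ψ z) := by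
      refine (hasFDerivAt_id _).congr_of_eventuallyEq ?_
      filter_upwards [R.open_source.mem_nhds (R.map_target hzt)] with y hy
      have := R.left_inv hy
      rwa [hR] at this
    exact congrArg (fun L ↦ L v) (h1.unique h2)
  have hpψ : ∀ z, Good z → p (ψ z) = z.2 := fun z hz ↦ by
    have := R.right_inv hz.1
    rw [hR] at this
    exact congrArg Prod.snd this
  have hFd : ∀ z, Good z → fderiv ℝ F z = fderiv ℝ φ (ψ z) ∘L fderiv ℝ ψ z := fun z hz ↦
    (hz.2.2.1.differentiableAt.hasFDerivAt.comp z hz.2.1.differentiableAt.hasFDerivAt).fderiv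
  have hFd' : ∀ z, Good z → HasFDerivAt F (fderiv ℝ F z) z := fun z hz ↦ by
    rw [hFd z hz]
    exact hz.2.2.1.differentiableAt.hasFDerivAt.comp z hz.2.1.differentiableAt.hasFDerivAt
  set ηp : W × ℝ → ℝ := fun z ↦ fderiv ℝ p (ψ z) (ξ (ψ z))
  have hηp : ContinuousAt ηp (y₀, 0) := by
    have h1 : ContinuousAt (fun x ↦ fderiv ℝ p x (ξ x)) x₀ :=
      hp.fderiv.continuousAt.clm_apply hξ
    rw [← hψ0] at h1
    exact h1.comp hRs.continuousAt
  have hηp0 : ηp (y₀, 0) ≠ 0 := by simpa only [ηp, hψ0] using htr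
  -- The `y`-component of `ξ` is `A (Ξ (F z))` by relatedness, so the relation reads `ηp ∂_t F =
  -- Ξ(F) - ∂_y F · A Ξ(F)`. Apart from `Ξ`, the field enters only through `ηp`, so continuity of
  -- `ξ` is enough.
  have hrelF : ∀ z, Good z → ηp z • fderiv ℝ F z (0, 1) =
      Ξ (F z) - fderiv ℝ F z (A (Ξ (F z)), 0) := by
    intro z hz
    have h1 : fderiv ℝ F z (A (Ξ (F z)), ηp z) = Ξ (F z) := by
      have h2 := hψΨ z hz (ξ (ψ z))
      rw [hz.2.2.2.2.1] at h2
      rw [hFd z hz]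
      change fderiv ℝ φ (ψ z) (fderiv ℝ ψ z (A (Ξ (φ (ψ z))), fderiv ℝ p (ψ z) (ξ (ψ z)))) = _
      rw [h2, hz.2.2.2.2.1]
    have h3 : (A (Ξ (F z)), ηp z) = (A (Ξ (F z)), 0) + ηp z • ((0 : W), (1 : ℝ)) := by simp
    rw [h3, map_add, map_smul] at h1
    rw [eq_sub_iff_add_eq, add_comm, h1]
  -- A kernel vector of `dφ` has zero `y`-component, so on `t = 0` the kernel is spanned by the
  -- `t`-direction.
  have hFt : ∀ z, Good z → z.2 = 0 → fderiv ℝ F z (0, 1) = 0 := by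
    intro z hz hz2
    have h1 := hz.2.2.2.2.2 ((hpψ z hz).trans hz2)
    rw [injective_iff_map_eq_zero] at h1
    push Not at h1
    obtain ⟨v, hv, hv0⟩ := h1
    have h2 := hψΨ z hz v
    rw [hv, map_zero] at h2
    have h3 : ((0 : W), fderiv ℝ p (ψ z) v) = fderiv ℝ p (ψ z) v • ((0 : W), (1 : ℝ)) := by simp
    have hs : fderiv ℝ p (ψ z) v ≠ 0 := by
      intro h0
      rw [h0] at h2
      exact hv0 (h2.symm.trans (map_zero _))
    have h4 : fderiv ℝ F z ((0 : W), fderiv ℝ p (ψ z) v) = 0 := by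
      rw [hFd z hz, ContinuousLinearMap.comp_apply, h2, hv]
    rw [h3, map_smul] at h4
    exact (smul_eq_zero.1 h4).resolve_left hs
  -- Compare `F (y, t)` with `F (y, 0)`. At `t = 0` both sides of the evolution equation vanish;
  -- subtracting there and using that `Ξ` is Lipschitz bounds `∂_t H` by `H` and `∂_y H`.
  set H : W × ℝ → V := fun z ↦ F z - F (τ z)
  have hH : AnalyticAt ℝ H (y₀, 0) := hF0.sub (AnalyticAt.fun_comp (f := τ) hF0 (hτ _))
  have hHd : ∀ z, Good z → Good (τ z) → HasFDerivAt H
      (fderiv ℝ F z - fderiv ℝ F (τ z) ∘L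
        (ContinuousLinearMap.fst ℝ W ℝ).prod (0 : W × ℝ →L[ℝ] ℝ)) z := by
    intro z hz hz'
    have hτd : HasFDerivAt τ ((ContinuousLinearMap.fst ℝ W ℝ).prod (0 : W × ℝ →L[ℝ] ℝ)) z :=
      hasFDerivAt_fst.prodMk (hasFDerivAt_const (0 : ℝ) z)
    exact (hFd' z hz).sub ((hFd' _ hz').comp z hτd)
  have hHt : ∀ z, Good z → Good (τ z) → fderiv ℝ H z (0, 1) = fderiv ℝ F z (0, 1) := by
    intro z hz hz'
    rw [(hHd z hz hz').fderiv]
    change fderiv ℝ F z (0, 1) - fderiv ℝ F (τ z) (0, 0) = _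
    rw [Prod.mk_zero_zero, map_zero, sub_zero]
  have hHy : ∀ z, Good z → Good (τ z) → ∀ w : W,
      (fderiv ℝ H z ∘L ContinuousLinearMap.inl ℝ W ℝ) w =
        fderiv ℝ F z (w, 0) - fderiv ℝ F (τ z) (w, 0) := by
    intro z hz hz' w
    rw [(hHd z hz hz').fderiv]
    rfl
  obtain ⟨K, s, hs, hK⟩ := hΞ.exists_lipschitzOnWith
  have hFx : F (y₀, 0) = φ x₀ := by simp only [F, hψ0]
  have hs : ∀ᶠ z in 𝓝 (y₀, (0 : ℝ)), F z ∈ s := by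
    have := hF0.continuousAt
    rw [ContinuousAt, hFx] at this
    exact this.eventually hs
  have hbF : ∃ K₁, ∀ᶠ z in 𝓝 (y₀, (0 : ℝ)), ‖fderiv ℝ F z‖ ≤ K₁ :=
    ⟨‖fderiv ℝ F (y₀, 0)‖ + 1, (hF0.fderiv.continuousAt.norm.eventually_lt continuousAt_const
      (lt_add_one _)).mono fun _ h ↦ h.le⟩
  have hbΞ : ∃ K₂, ∀ᶠ z in 𝓝 (y₀, (0 : ℝ)), ‖Ξ (F z)‖ ≤ K₂ := by
    have h1 : ContinuousAt (fun z ↦ Ξ (F z)) (y₀, 0) := by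
      refine ContinuousAt.comp (g := Ξ) ?_ hF0.continuousAt
      rw [hFx]
      exact hΞ.continuousAt
    exact ⟨‖Ξ (F (y₀, 0))‖ + 1, (h1.norm.eventually_lt continuousAt_const
      (lt_add_one _)).mono fun _ h ↦ h.le⟩
  obtain ⟨K₁, hK₁⟩ := hbF
  obtain ⟨K₂, hK₂⟩ := hbΞ
  have hc : ∀ᶠ z in 𝓝 (y₀, (0 : ℝ)), ‖ηp (y₀, 0)‖ / 2 ≤ ‖ηp z‖ :=
    (continuousAt_const.eventually_lt hηp.norm
      (half_lt_self (norm_pos_iff.2 hηp0))).mono fun _ h ↦ h.le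
  set c := ‖ηp (y₀, 0)‖ / 2
  have hcpos : 0 < c := half_pos (norm_pos_iff.2 hηp0)
  have hbound : ∀ᶠ z in 𝓝 (y₀, (0 : ℝ)), ‖fderiv ℝ H z (0, 1)‖ ≤
      ((K + K₁ * (‖A‖ * K) + ‖A‖ * K₂) / c) *
        (‖H z‖ + ‖fderiv ℝ H z ∘L ContinuousLinearMap.inl ℝ W ℝ‖) := by
    filter_upwards [hGood, hτlim.eventually hGood, hs, hτlim.eventually hs,
      hτlim.eventually hK₁, hK₂, hc] with z hz hz' hsz hsz' h1 h2 h3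
    set D := Ξ (F z) - Ξ (F (τ z))
    set T := fderiv ℝ H z ∘L ContinuousLinearMap.inl ℝ W ℝ
    have hD : ‖D‖ ≤ K * ‖H z‖ := hK.norm_sub_le hsz hsz'
    have h0 : Ξ (F (τ z)) - fderiv ℝ F (τ z) (A (Ξ (F (τ z))), 0) = 0 := by
      rw [← hrelF _ hz', hFt _ hz' rfl, smul_zero]
    have hsplit : ηp z • fderiv ℝ F z (0, 1) =
        D - fderiv ℝ F (τ z) (A D, 0) - T (A (Ξ (F z))) := by
      have hl : ((A D, 0) : W × ℝ) = (A (Ξ (F z)), 0) - (A (Ξ (F (τ z))), 0) := by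
        simp [D]
      rw [hrelF z hz, hHy z hz hz', hl, map_sub]
      simp only [D]
      rw [sub_eq_zero] at h0
      rw [← h0]
      abel
    have hA1 : ∀ v, ‖((A v, 0) : W × ℝ)‖ ≤ ‖A‖ * ‖v‖ := fun v ↦ by
      simpa using A.le_opNorm v
    have hK₁0 : 0 ≤ K₁ := (norm_nonneg _).trans h1
    have hn1 : ‖fderiv ℝ F (τ z) (A D, 0)‖ ≤ K₁ * (‖A‖ * (K * ‖H z‖)) := by
      refine (ContinuousLinearMap.le_opNorm _ _).trans ?_
      have := (hA1 D).trans (mul_le_mul_of_nonneg_left hD (norm_nonneg A))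
      gcongr
    have hn2 : ‖T (A (Ξ (F z)))‖ ≤ ‖T‖ * (‖A‖ * K₂) := by
      refine (ContinuousLinearMap.le_opNorm _ _).trans ?_
      have := (A.le_opNorm (Ξ (F z))).trans (mul_le_mul_of_nonneg_left h2 (norm_nonneg A))
      gcongr
    have hn3 : c * ‖fderiv ℝ F z (0, 1)‖ ≤
        K * ‖H z‖ + K₁ * (‖A‖ * (K * ‖H z‖)) + ‖T‖ * (‖A‖ * K₂) := by
      calc c * ‖fderiv ℝ F z (0, 1)‖ ≤ ‖ηp z‖ * ‖fderiv ℝ F z (0, 1)‖ := by gcongr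
        _ = ‖D - fderiv ℝ F (τ z) (A D, 0) - T (A (Ξ (F z)))‖ := by rw [← norm_smul, hsplit]
        _ ≤ ‖D‖ + ‖fderiv ℝ F (τ z) (A D, 0)‖ + ‖T (A (Ξ (F z)))‖ :=
          (norm_sub_le _ _).trans (by gcongr; exact norm_sub_le _ _)
        _ ≤ _ := by gcongr
    rw [hHt z hz hz', div_mul_eq_mul_div, le_div_iff₀ hcpos, mul_comm _ c]
    refine hn3.trans ?_
    have hK₂0 : 0 ≤ K₂ := (norm_nonneg _).trans h2
    have e1 : 0 ≤ (K + K₁ * (‖A‖ * K)) * ‖T‖ := by positivity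
    have e2 : 0 ≤ ‖A‖ * K₂ * ‖H z‖ := by positivity
    nlinarith [e1, e2]
  have hH0 := hH.eventually_eq_zero_of_norm_lastDeriv_le (y₀ := y₀)
    (Eventually.of_forall fun z hz ↦ by
      have : τ z = z := Prod.ext rfl hz.symm
      simp only [H, this, sub_self]) hbound
  have hΨlim : Tendsto Ψ (𝓝 x₀) (𝓝 (y₀, 0)) := by
    have := hΨ.continuousAt.tendsto
    rwa [hΨx] at this
  filter_upwards [hΨlim.eventually hGood, hΨlim.eventually (hτlim.eventually hGood),
    hΨlim.eventually hH0.eventually_nhds, R.open_source.mem_nhds hxR] with x hx hx' hHx hxs hinj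
  have hxψ : ψ (Ψ x) = x := by
    have := R.left_inv hxs
    rwa [hR] at this
  -- Now `∂_t F = 0`, so `dφ` kills `∂_t ψ`, which is nonzero because `dp` takes the value `1` on
  -- it.
  have h1 : fderiv ℝ H (Ψ x) = 0 :=
    ((hasFDerivAt_const (0 : V) (Ψ x)).congr_of_eventuallyEq hHx).fderiv
  have h2 := hHt _ hx hx'
  rw [h1, hFd _ hx] at h2
  change (0 : V) = fderiv ℝ φ (ψ (Ψ x)) (fderiv ℝ ψ (Ψ x) (0, 1)) at h2
  have h3 := (hΨψ _ hx (0, 1)).2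
  rw [hxψ] at h2 h3
  rw [← map_zero (fderiv ℝ φ x)] at h2
  rw [← hinj h2, map_zero] at h3
  exact zero_ne_one h3

end RelatedFields

namespace JacobiContact

/-! ### Algebra of `a ∧ b ∧ ⋯ ∧ b`. -/

section WedgePow

/-- Used with `ε = 1` for pulling covectors back by `dφ`, and with `ε = -1` because `π(♭u, ♭v) =
-dα(u, v)`. -/
theorem wedgePow_comp_eq {X Y : Type*} {n : ℕ} {a : X → ℝ} {b : X → X → ℝ} {a' : Y → ℝ}
    {b' : Y → Y → ℝ} {g : Y → X} {ε : ℝ} (ha : ∀ u, a (g u) = a' u)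
    (hb : ∀ u w, b (g u) (g w) = ε * b' u w) (v : Fin (2 * n + 1) → Y) :
    wedgePow n a b (fun i ↦ g (v i)) = ε ^ n * wedgePow n a' b' v := by
  simp only [wedgePow, ha, hb, Finset.prod_mul_distrib, Finset.prod_const, Finset.card_univ,
    Fintype.card_fin, Finset.mul_sum]
  refine Finset.sum_congr rfl fun σ _ ↦ ?_
  ring

variable {X : Type*} [AddCommGroup X] [Module ℝ X]

/-- The multilinear map whose alternatization is the wedge product `a ∧ b ∧ ⋯ ∧ b`. -/
def wedgePowMultilinear (n : ℕ) (a : X →ₗ[ℝ] ℝ) (b : X →ₗ[ℝ] X →ₗ[ℝ] ℝ) :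
    MultilinearMap ℝ (fun _ : Fin (2 * n + 1) ↦ X) ℝ :=
  let f : (Fin (2 * n + 1) → X) → Fin n → ℝ := fun v i ↦
    b (v ⟨2 * (i : ℕ) + 1, by omega⟩) (v ⟨2 * (i : ℕ) + 2, by omega⟩)
  -- Each slot occurs in exactly one factor: slot `0` in `a`, slots `2i + 1` and `2i + 2` in the
  -- `i`-th copy of `b`.
  have hpos : ∀ k : Fin (2 * n + 1), k = 0 ∨ ∃ i : Fin n,
      k = ⟨2 * (i : ℕ) + 1, by omega⟩ ∨ k = ⟨2 * (i : ℕ) + 2, by omega⟩ := by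
    intro k
    by_cases hk : k = 0
    · exact .inl hk
    · have hk0 : (k : ℕ) ≠ 0 := fun h ↦ hk (Fin.ext h)
      refine .inr ⟨⟨((k : ℕ) - 1) / 2, by omega⟩, ?_⟩
      simp only [Fin.ext_iff]
      omega
  have h0 : ∀ (v : Fin (2 * n + 1) → X) (x : X) (j : Fin n), f (Function.update v 0 x) j = f v j := by
    intro v x j
    simp only [f]
    rw [Function.update_of_ne (by simp [Fin.ext_iff]), Function.update_of_ne (by simp [Fin.ext_iff])]
  have hodd : ∀ (v : Fin (2 * n + 1) → X) (x : X) (i : Fin n),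
      a (Function.update v ⟨2 * (i : ℕ) + 1, by omega⟩ x 0) *
        ∏ j, f (Function.update v ⟨2 * (i : ℕ) + 1, by omega⟩ x) j =
      (a (v 0) * ∏ j ∈ Finset.univ.erase i, f v j) * b x (v ⟨2 * (i : ℕ) + 2, by omega⟩) := by
    intro v x i
    rw [Function.update_of_ne (by simp [Fin.ext_iff]),
      ← Finset.mul_prod_erase _ _ (Finset.mem_univ i),
      Finset.prod_congr rfl fun j (hj : j ∈ Finset.univ.erase i) ↦ show _ = f v j by
        have hji := Fin.val_ne_of_ne (Finset.ne_of_mem_erase hj)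
        simp only [f]
        rw [Function.update_of_ne (by simp only [ne_eq, Fin.ext_iff]; omega),
          Function.update_of_ne (by simp only [ne_eq, Fin.ext_iff]; omega)]]
    have : f (Function.update v ⟨2 * (i : ℕ) + 1, by omega⟩ x) i =
        b x (v ⟨2 * (i : ℕ) + 2, by omega⟩) := by
      simp only [f]
      rw [Function.update_self, Function.update_of_ne (by simp [Fin.ext_iff])]
    rw [this]
    ring
  have heven : ∀ (v : Fin (2 * n + 1) → X) (x : X) (i : Fin n),
      a (Function.update v ⟨2 * (i : ℕ) + 2, by omega⟩ x 0) *
        ∏ j, f (Function.update v ⟨2 * (i : ℕ) + 2, by omega⟩ x) j =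
      (a (v 0) * ∏ j ∈ Finset.univ.erase i, f v j) * b (v ⟨2 * (i : ℕ) + 1, by omega⟩) x := by
    intro v x i
    rw [Function.update_of_ne (by simp [Fin.ext_iff]),
      ← Finset.mul_prod_erase _ _ (Finset.mem_univ i),
      Finset.prod_congr rfl fun j (hj : j ∈ Finset.univ.erase i) ↦ show _ = f v j by
        have hji := Fin.val_ne_of_ne (Finset.ne_of_mem_erase hj)
        simp only [f]
        rw [Function.update_of_ne (by simp only [ne_eq, Fin.ext_iff]; omega),
          Function.update_of_ne (by simp only [ne_eq, Fin.ext_iff]; omega)]]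
    have : f (Function.update v ⟨2 * (i : ℕ) + 2, by omega⟩ x) i =
        b (v ⟨2 * (i : ℕ) + 1, by omega⟩) x := by
      simp only [f]
      rw [Function.update_self, Function.update_of_ne (by simp [Fin.ext_iff])]
    rw [this]
    ring
  MultilinearMap.mk' (fun v ↦ a (v 0) * ∏ i, f v i)
    (by
      intro v k x y
      rcases hpos k with rfl | ⟨i, rfl | rfl⟩
      · simp only [h0, Function.update_self, map_add]
        ring
      · simp only [hodd, map_add, LinearMap.add_apply]
        ring
      · simp only [heven, map_add]
        ring)
    (by
      intro v k c x
      rcases hpos k with rfl | ⟨i, rfl | rfl⟩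
      · simp only [h0, Function.update_self, map_smul, smul_eq_mul]
        ring
      · simp only [hodd, map_smul, LinearMap.smul_apply, smul_eq_mul]
        ring
      · simp only [heven, map_smul, smul_eq_mul]
        ring)

theorem wedgePow_eq_alternatization (n : ℕ) (a : X →ₗ[ℝ] ℝ) (b : X →ₗ[ℝ] X →ₗ[ℝ] ℝ)
    (v : Fin (2 * n + 1) → X) :
    wedgePow n a (fun x y ↦ b x y) v =
      (1 / 2 ^ n : ℝ) * MultilinearMap.alternatization (wedgePowMultilinear n a b) v := by
  rw [wedgePow, MultilinearMap.alternatization_apply]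
  congr 1
  refine Finset.sum_congr rfl fun σ _ ↦ ?_
  rw [Units.smul_def, zsmul_eq_mul]
  rfl

theorem linearIndependent_of_wedgePow_ne_zero {n : ℕ} {a : X →ₗ[ℝ] ℝ} {b : X →ₗ[ℝ] X →ₗ[ℝ] ℝ}
    {v : Fin (2 * n + 1) → X} (h : wedgePow n a (fun x y ↦ b x y) v ≠ 0) :
    LinearIndependent ℝ v := by
  by_contra hv
  rw [wedgePow_eq_alternatization, AlternatingMap.map_linearDependent _ _ hv, mul_zero] at h
  exact h rfl

end WedgePow

/-! ### Linear algebra of a contact form at one point. -/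

section LinearContact

variable {X : Type*} [NormedAddCommGroup X] [NormedSpace ℝ X]

/-- The Jacobi structure `(P, e)` of a linear contact structure `(a, w)`, where `w` plays the role
of the exterior derivative of the contact form `a`. -/
structure IsLinearContact (a : X →L[ℝ] ℝ) (w : X →L[ℝ] X →L[ℝ] ℝ)
    (P : (X →L[ℝ] ℝ) → (X →L[ℝ] ℝ) → ℝ) (e : X) : Prop where
  skew : ∀ u v, w u v = - w v u
  form_reeb : a e = 1
  deriv_reeb : ∀ u, w e u = 0
  tensor : ∀ (u : X) (γ : X →L[ℝ] ℝ), P (w u + a u • a) γ = γ u - a u * γ e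

namespace IsLinearContact

variable {a : X →L[ℝ] ℝ} {w : X →L[ℝ] X →L[ℝ] ℝ} {P : (X →L[ℝ] ℝ) → (X →L[ℝ] ℝ) → ℝ} {e : X}

/-- The map `u ↦ ι_u w + a(u) a`. -/
noncomputable def flat (a : X →L[ℝ] ℝ) (w : X →L[ℝ] X →L[ℝ] ℝ) : X →L[ℝ] X →L[ℝ] ℝ :=
  w + a.smulRight a

theorem flat_apply (u : X) : flat a w u = w u + a u • a := rfl

variable (h : IsLinearContact a w P e)
include h

theorem flat_apply_reeb (u : X) : flat a w u e = a u := by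
  simp [flat_apply, h.form_reeb, h.skew u e, h.deriv_reeb]

theorem flat_reeb : flat a w e = a := by
  ext u
  simp [flat_apply, h.form_reeb, h.deriv_reeb]

theorem tensor_flat (u : X) (γ : X →L[ℝ] ℝ) : P (flat a w u) γ = γ (u - a u • e) := by
  rw [flat_apply, h.tensor, map_sub, map_smul, smul_eq_mul]

theorem tensor_flat_flat (u v : X) : P (flat a w u) (flat a w v) = - w u v := by
  rw [flat_apply, h.tensor, h.flat_apply_reeb, flat_apply, h.skew u v]
  simp [mul_comm]

theorem flat_injective : Function.Injective (flat a w) := by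
  refine (injective_iff_map_eq_zero _).2 fun u hu ↦ ?_
  have h1 : a u = 0 := by rw [← h.flat_apply_reeb, hu]; rfl
  by_contra hne
  obtain ⟨γ, hγ⟩ := SeparatingDual.exists_ne_zero (R := ℝ) hne
  have h2 := h.tensor_flat u γ
  -- `P` is a bare function, so `P 0 γ = 0` has to be read off from the axiom at `u = 0`.
  have h3 := h.tensor_flat 0 γ
  rw [map_zero] at h3
  rw [hu, h3] at h2
  simp [h1] at h2
  exact hγ h2.symm

variable [FiniteDimensional ℝ X]

theorem exists_equiv : ∃ b : X ≃L[ℝ] (X →L[ℝ] ℝ), (b : X →L[ℝ] X →L[ℝ] ℝ) = flat a w := by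
  have hdim : Module.finrank ℝ X = Module.finrank ℝ (X →L[ℝ] ℝ) := by
    have h1 : Module.finrank ℝ (X →L[ℝ] ℝ) = Module.finrank ℝ (X →ₗ[ℝ] ℝ) :=
      (LinearMap.toContinuousLinearMap (𝕜 := ℝ) (E := X) (F' := ℝ)).finrank_eq.symm
    rw [h1]
    exact (Subspace.dual_finrank_eq (K := ℝ) (V := X)).symm
  refine ⟨(LinearMap.linearEquivOfInjective (flat a w : X →ₗ[ℝ] X →L[ℝ] ℝ) h.flat_injective
    hdim).toContinuousLinearEquiv, ?_⟩
  ext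
  rfl

theorem flat_inverse (β : X →L[ℝ] ℝ) : flat a w ((flat a w).inverse β) = β := by
  obtain ⟨b, hb⟩ := h.exists_equiv
  rw [← hb, ContinuousLinearMap.inverse_equiv]
  exact b.apply_symm_apply β

theorem inverse_flat (u : X) : (flat a w).inverse (flat a w u) = u :=
  h.flat_injective (h.flat_inverse _)

/-- A covector whose contractions with the tensor and with the Reeb vector vanish is zero. -/
theorem covector_eq_zero {q : X →L[ℝ] ℝ} {L : X →L[ℝ] X} (hL : ∀ v, q v = 0 → L v = 0 → v = 0)
    (hP : ∀ γ : X →L[ℝ] ℝ, P (γ ∘L L) q = 0) (he : q e = 0) : q = 0 := by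
  set u := (flat a w).inverse q
  have hu : flat a w u = q := h.flat_inverse q
  have hP' : ∀ γ : X →L[ℝ] ℝ, P q γ = - P γ q := by
    intro γ
    rw [← hu, ← h.flat_inverse γ, h.tensor_flat_flat, h.tensor_flat_flat, h.skew]
  -- The vector `u - a u • e` is the contraction of the tensor with `q`. It is killed by `L` by
  -- hypothesis and by `q` by skew-symmetry, hence is zero; `q e = 0` removes the remaining Reeb
  -- component.
  have hLu : L (u - a u • e) = 0 := by
    by_contra hne
    obtain ⟨γ, hγ⟩ := SeparatingDual.exists_ne_zero (R := ℝ) hne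
    apply hγ
    have := h.tensor_flat u (γ ∘L L)
    rw [hu, hP', hP, neg_zero] at this
    exact this.symm
  have hqu : q (u - a u • e) = 0 := by
    have h1 := h.tensor_flat u q
    rw [hu] at h1
    have h2 := hP' q
    linarith
  have h3 := sub_eq_zero.1 (hL _ hqu hLu)
  have h4 : a u = 0 := by rw [← h.flat_apply_reeb, hu, he]
  rw [h4, zero_smul] at h3
  rw [← hu, h3, map_zero]

end IsLinearContact

end LinearContact

/-! ### The local obstruction. -/

section Local

open Filter Topology IsLinearContact

variable {X W : Type*} [NormedAddCommGroup X] [NormedSpace ℝ X] [FiniteDimensional ℝ X]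
  [NormedAddCommGroup W] [NormedSpace ℝ W] [FiniteDimensional ℝ W]

/-- A Jacobi map from a contact structure to a Jacobi structure of the same dimension cannot be
singular along a hypersurface on which it is immersive, unless it is singular everywhere. -/
theorem not_injective_fderiv_of_contact {φ : X → X} {p : X → ℝ} {x₀ : X} {A : X →L[ℝ] W}
    {a : X → X →L[ℝ] ℝ} {w : X → X →L[ℝ] X →L[ℝ] ℝ} {P : X → (X →L[ℝ] ℝ) → (X →L[ℝ] ℝ) → ℝ}
    {e : X → X} (hdim : Module.finrank ℝ X = Module.finrank ℝ W + 1)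
    (hφ : AnalyticAt ℝ φ x₀) (hp : AnalyticAt ℝ p x₀) (hp0 : p x₀ = 0) (hp1 : fderiv ℝ p x₀ ≠ 0)
    (hA : ∀ v, fderiv ℝ p x₀ v = 0 → A (fderiv ℝ φ x₀ v) = 0 → v = 0)
    (hsing : ∀ᶠ x in 𝓝 x₀, p x = 0 → ¬ Function.Injective (fderiv ℝ φ x))
    (ha : ContinuousAt a x₀) (hw : ContinuousAt w x₀)
    (hcontact : ∀ᶠ x in 𝓝 x₀, IsLinearContact (a x) (w x) (P x) (e x))
    (hvector : ∃ Ξ : X → X, ContDiffAt ℝ 1 Ξ (φ x₀) ∧ ∀ᶠ x in 𝓝 x₀, fderiv ℝ φ x (e x) = Ξ (φ x))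
    (htensor : ∀ γ : X →L[ℝ] ℝ, ∃ Ξ : X → X, ContDiffAt ℝ 1 Ξ (φ x₀) ∧ ∀ᶠ x in 𝓝 x₀,
      ∀ δ : X →L[ℝ] ℝ, P x (γ ∘L fderiv ℝ φ x) (δ ∘L fderiv ℝ φ x) = δ (Ξ (φ x))) :
    ∀ᶠ x in 𝓝 x₀, ¬ Function.Injective (fderiv ℝ φ x) := by
  by_contra hcon
  have hc0 := hcontact.self_of_nhds
  have hflat : ContinuousAt (fun x ↦ flat (a x) (w x)) x₀ := by
    have h1 : ContinuousAt (fun x ↦ (a x).smulRight (a x)) x₀ :=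
      ((ContinuousLinearMap.smulRightL ℝ X (X →L[ℝ] ℝ)).continuous.continuousAt.comp ha).clm_apply
        ha
    have h2 : IsTopologicalAddGroup (X →L[ℝ] X →L[ℝ] ℝ) := inferInstance
    have h3 : ContinuousAdd (X →L[ℝ] X →L[ℝ] ℝ) := h2.toContinuousAdd
    exact hw.add h1
  obtain ⟨b, hb⟩ := hc0.exists_equiv
  have hinv : ContinuousAt (fun x ↦ (flat (a x) (w x)).inverse) x₀ := by
    have h1 : ContinuousAt ContinuousLinearMap.inverse (flat (a x₀) (w x₀)) := by
      rw [← hb]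
      exact (contDiffAt_map_inverse (n := 0) b).continuousAt
    exact ContinuousAt.comp (g := ContinuousLinearMap.inverse) h1 hflat
  -- Continuity of the Reeb field is not given; it follows from `e = ♭⁻¹ a`.
  have hcontE : ContinuousAt (fun x ↦ (flat (a x) (w x)).inverse (a x)) x₀ := hinv.clm_apply ha
  have hE : ∀ᶠ x in 𝓝 x₀, (flat (a x) (w x)).inverse (a x) = e x := by
    filter_upwards [hcontact] with x hx
    have := hx.inverse_flat (e x)
    rwa [hx.flat_reeb] at this
  have he : ContinuousAt e x₀ := hcontE.congr hE
  -- It remains to see that `dp` annihilates every projectable field: one transverse to `p = 0`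
  -- would contradict `hcon` through `not_injective_fderiv_of_related`.
  apply hp1
  refine hc0.covector_eq_zero (L := fderiv ℝ φ x₀) (fun v h1 h2 ↦ hA v h1 (by simp [h2]))
    (fun γ ↦ ?_) ?_
  · by_contra hne
    obtain ⟨Ξ, hΞ, hrel⟩ := htensor γ
    set u : X → X := fun x ↦ (flat (a x) (w x)).inverse (γ ∘L fderiv ℝ φ x)
    have hu : ContinuousAt u x₀ := by
      refine hinv.clm_apply ?_
      exact ((ContinuousLinearMap.compL ℝ X X ℝ γ).continuous.continuousAt).comp
        hφ.fderiv.continuousAt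
    have hξ : ∀ x, IsLinearContact (a x) (w x) (P x) (e x) → ∀ δ : X →L[ℝ] ℝ,
        P x (γ ∘L fderiv ℝ φ x) δ = δ (u x - a x (u x) • e x) := by
      intro x hx δ
      rw [← hx.tensor_flat, hx.flat_inverse]
    refine hcon (not_injective_fderiv_of_related (ξ := fun x ↦ u x - a x (u x) • e x) (Ξ := Ξ)
      hdim hφ hp hp0 hA hsing (hu.sub ((ha.clm_apply hu).smul he)) hΞ ?_ ?_)
    · filter_upwards [hcontact, hrel] with x hx hx'
      by_contra hne
      obtain ⟨δ, hδ⟩ := SeparatingDual.exists_ne_zero (R := ℝ) (sub_ne_zero.2 hne)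
      apply hδ
      rw [map_sub, ← hx', hξ x hx, sub_eq_zero]
      rfl
    · rwa [← hξ x₀ hc0]
  · by_contra hne
    obtain ⟨Ξ, hΞ, hrel⟩ := hvector
    exact hcon (not_injective_fderiv_of_related hdim hφ hp hp0 hA hsing he hΞ hrel hne)

end Local

/-! ### Derivatives of functions and maps read in charts. -/

section Charts

open Set Filter Topology

/-- The chain rule for vector-valued functions on manifolds. -/
theorem mvfderiv_comp_mfderiv {E H E' H' F M M' : Type*} [NormedAddCommGroup E] [NormedSpace ℝ E]
    [TopologicalSpace H] {I : ModelWithCorners ℝ E H} [NormedAddCommGroup E'] [NormedSpace ℝ E']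
    [TopologicalSpace H'] {J : ModelWithCorners ℝ E' H'} [NormedAddCommGroup F] [NormedSpace ℝ F]
    [TopologicalSpace M] [ChartedSpace H M] [TopologicalSpace M'] [ChartedSpace H' M']
    {g : M → F} {f : M' → M} (x : M') (hg : MDifferentiableAt I 𝓘(ℝ, F) g (f x))
    (hf : MDifferentiableAt J I f x) :
    mvfderiv J (g ∘ f) x = mvfderiv I g (f x) ∘L mfderiv J I f x :=
  mfderiv_comp x hg hf

variable {d : ℕ} {M : Type*} [TopologicalSpace M] [ChartedSpace (EuclideanSpace ℝ (Fin d)) M]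

/-- The derivative of the preferred chart at `x₀`. -/
noncomputable abbrev chartDeriv (x₀ x : M) : TangentSpace (𝓡 d) x →L[ℝ] EuclideanSpace ℝ (Fin d) :=
  mvfderiv (𝓡 d) (extChartAt (𝓡 d) x₀) x

/-- The derivative of the inverse of the preferred chart at `x₀`. -/
noncomputable abbrev chartSymmDeriv (x₀ : M) (y : EuclideanSpace ℝ (Fin d)) :
    EuclideanSpace ℝ (Fin d) →L[ℝ] TangentSpace (𝓡 d) ((extChartAt (𝓡 d) x₀).symm y) :=
  mfderiv 𝓘(ℝ, EuclideanSpace ℝ (Fin d)) (𝓡 d) (extChartAt (𝓡 d) x₀).symm y ∘L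
      (NormedSpace.fromTangentSpace (𝕜 := ℝ) y).symm.toContinuousLinearMap

variable [IsManifold (𝓡 d) ω M]

theorem chartDeriv_comp_chartSymmDeriv {x₀ : M} {y : EuclideanSpace ℝ (Fin d)}
    (hy : y ∈ (extChartAt (𝓡 d) x₀).target) (v : EuclideanSpace ℝ (Fin d)) :
    chartDeriv x₀ ((extChartAt (𝓡 d) x₀).symm y) (chartSymmDeriv x₀ y v) = v := by
  have h := mfderiv_extChartAt_comp_mfderivWithin_extChartAt_symm (I := 𝓡 d) hy
  rw [ModelWithCorners.range_eq_univ, mfderivWithin_univ] at h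
  exact congrArg (fun L ↦ L v) h

theorem chartSymmDeriv_comp_chartDeriv {x₀ : M} {y : EuclideanSpace ℝ (Fin d)}
    (hy : y ∈ (extChartAt (𝓡 d) x₀).target)
    (v : TangentSpace (𝓡 d) ((extChartAt (𝓡 d) x₀).symm y)) :
    chartSymmDeriv x₀ y (chartDeriv x₀ ((extChartAt (𝓡 d) x₀).symm y) v) = v := by
  have h := mfderivWithin_extChartAt_symm_comp_mfderiv_extChartAt (I := 𝓡 d) hy
  rw [ModelWithCorners.range_eq_univ, mfderivWithin_univ] at h
  exact congrArg (fun L ↦ L v) h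

variable {F : Type*} [NormedAddCommGroup F] [NormedSpace ℝ F]

theorem mvfderiv_comp_extChartAt {x₀ x : M} {g : EuclideanSpace ℝ (Fin d) → F}
    (hx : x ∈ (extChartAt (𝓡 d) x₀).source)
    (hg : DifferentiableAt ℝ g (extChartAt (𝓡 d) x₀ x)) :
    mvfderiv (𝓡 d) (g ∘ extChartAt (𝓡 d) x₀) x =
      fderiv ℝ g (extChartAt (𝓡 d) x₀ x) ∘L chartDeriv x₀ x := by
  rw [mvfderiv_comp_mfderiv (I := 𝓘(ℝ, EuclideanSpace ℝ (Fin d))) (J := 𝓡 d) (g := g)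
    (f := extChartAt (𝓡 d) x₀) x hg.mdifferentiableAt
    (mdifferentiableAt_extChartAt (by rwa [extChartAt_source] at hx))]
  ext v
  simp only [mvfderiv, mfderiv_eq_fderiv]
  rfl

/-- The derivative of the expression of a vector-valued function in a chart. -/
theorem mvfderiv_eq_fderiv_comp_chartDeriv {x₀ : M} {y : EuclideanSpace ℝ (Fin d)} {f : M → F}
    (hy : y ∈ (extChartAt (𝓡 d) x₀).target)
    (hf : DifferentiableAt ℝ (f ∘ (extChartAt (𝓡 d) x₀).symm) y) :
    mvfderiv (𝓡 d) f ((extChartAt (𝓡 d) x₀).symm y) =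
      fderiv ℝ (f ∘ (extChartAt (𝓡 d) x₀).symm) y ∘L
        chartDeriv x₀ ((extChartAt (𝓡 d) x₀).symm y) := by
  have hs := (extChartAt (𝓡 d) x₀).map_target hy
  have hr := (extChartAt (𝓡 d) x₀).right_inv hy
  have h1 := mvfderiv_comp_extChartAt (g := f ∘ (extChartAt (𝓡 d) x₀).symm) hs (by rwa [hr])
  rw [hr] at h1
  rw [← h1]
  have h2 : f =ᶠ[𝓝 ((extChartAt (𝓡 d) x₀).symm y)]
      (f ∘ (extChartAt (𝓡 d) x₀).symm) ∘ extChartAt (𝓡 d) x₀ := by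
    filter_upwards [(isOpen_extChartAt_source x₀).mem_nhds hs] with z hz
    simp only [Function.comp_apply, (extChartAt (𝓡 d) x₀).left_inv hz]
  have h3 := h2.mfderiv_eq (I := 𝓡 d) (I' := 𝓘(ℝ, F))
  have h4 := h2.self_of_nhds
  simp only [mvfderiv]
  ext v
  exact congrArg (fun L ↦ L v) h3

variable {S : Type*} [TopologicalSpace S] [ChartedSpace (EuclideanSpace ℝ (Fin d)) S]
  [IsManifold (𝓡 d) ω S]

/-- The expression of a map between manifolds in preferred charts. -/
noncomputable abbrev inCharts (φ : S → M) (s₀ : S) (x₀ : M) :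
    EuclideanSpace ℝ (Fin d) → EuclideanSpace ℝ (Fin d) :=
  extChartAt (𝓡 d) x₀ ∘ φ ∘ (extChartAt (𝓡 d) s₀).symm

theorem analyticAt_inCharts {φ : S → M} (hφ : ContMDiff (𝓡 d) (𝓡 d) ω φ) {s₀ : S} {x₀ : M}
    {y : EuclideanSpace ℝ (Fin d)} (hy : y ∈ (extChartAt (𝓡 d) s₀).target)
    (hx : φ ((extChartAt (𝓡 d) s₀).symm y) ∈ (extChartAt (𝓡 d) x₀).source) :
    AnalyticAt ℝ (inCharts φ s₀ x₀) y := by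
  have h1 : ContMDiffAt 𝓘(ℝ, EuclideanSpace ℝ (Fin d)) (𝓡 d) ω (extChartAt (𝓡 d) s₀).symm y :=
    (contMDiffOn_extChartAt_symm s₀).contMDiffAt ((isOpen_extChartAt_target s₀).mem_nhds hy)
  have h2 : ContMDiffAt (𝓡 d) 𝓘(ℝ, EuclideanSpace ℝ (Fin d)) ω (extChartAt (𝓡 d) x₀)
      (φ ((extChartAt (𝓡 d) s₀).symm y)) :=
    contMDiffAt_extChartAt' (by rwa [extChartAt_source] at hx)
  exact (h2.comp y ((hφ _).comp y h1)).contDiffAt.analyticAt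

theorem fderiv_inCharts_chartDeriv {φ : S → M} (hφ : ContMDiff (𝓡 d) (𝓡 d) ω φ) {s₀ : S} {x₀ : M}
    {y : EuclideanSpace ℝ (Fin d)} (hy : y ∈ (extChartAt (𝓡 d) s₀).target)
    (hx : φ ((extChartAt (𝓡 d) s₀).symm y) ∈ (extChartAt (𝓡 d) x₀).source)
    (v : TangentSpace (𝓡 d) ((extChartAt (𝓡 d) s₀).symm y)) :
    fderiv ℝ (inCharts φ s₀ x₀) y (chartDeriv s₀ ((extChartAt (𝓡 d) s₀).symm y) v) =
      chartDeriv x₀ (φ ((extChartAt (𝓡 d) s₀).symm y))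
        (mfderiv (𝓡 d) (𝓡 d) φ ((extChartAt (𝓡 d) s₀).symm y) v) := by
  have h1 := mvfderiv_eq_fderiv_comp_chartDeriv (f := extChartAt (𝓡 d) x₀ ∘ φ) hy
    (analyticAt_inCharts hφ hy hx).differentiableAt
  have h2 := mvfderiv_comp_mfderiv (I := 𝓡 d) (J := 𝓡 d) (g := extChartAt (𝓡 d) x₀) (f := φ)
    ((extChartAt (𝓡 d) s₀).symm y)
    (mdifferentiableAt_extChartAt (I := 𝓡 d) (x := x₀) (by rwa [extChartAt_source] at hx))
    ((hφ _).mdifferentiableAt (by simp))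
  exact congrArg (fun L ↦ L v) (h1.symm.trans h2)

theorem injective_fderiv_inCharts_iff {φ : S → M} (hφ : ContMDiff (𝓡 d) (𝓡 d) ω φ) {s₀ : S}
    {x₀ : M} {y : EuclideanSpace ℝ (Fin d)} (hy : y ∈ (extChartAt (𝓡 d) s₀).target)
    (hx : φ ((extChartAt (𝓡 d) s₀).symm y) ∈ (extChartAt (𝓡 d) x₀).source) :
    Function.Injective (fderiv ℝ (inCharts φ s₀ x₀) y) ↔
      Function.Injective (mfderiv (𝓡 d) (𝓡 d) φ ((extChartAt (𝓡 d) s₀).symm y)) := by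
  have key := fderiv_inCharts_chartDeriv hφ hy hx
  have hinj : Function.Injective (chartDeriv x₀ (φ ((extChartAt (𝓡 d) s₀).symm y))) :=
    (isInvertible_mfderiv_extChartAt (I := 𝓡 d) hx).injective
  refine ⟨fun h ↦ (injective_iff_map_eq_zero _).2 fun v hv ↦ ?_,
    fun h ↦ (injective_iff_map_eq_zero _).2 fun v hv ↦ ?_⟩
  · have h1 := key v
    rw [hv, map_zero] at h1
    have h2 := (injective_iff_map_eq_zero _).1 h _ h1
    rw [← chartSymmDeriv_comp_chartDeriv hy v, h2, map_zero]
  · have h1 := key (chartSymmDeriv s₀ y v)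
    rw [chartDeriv_comp_chartSymmDeriv hy, hv] at h1
    have h2 := (injective_iff_map_eq_zero _).1 hinj _ h1.symm
    have h3 := (injective_iff_map_eq_zero _).1 h _ h2
    rw [← chartDeriv_comp_chartSymmDeriv hy v, h3, map_zero]

end Charts

/-! ### Chart independence of the exterior derivative. -/

section ExteriorDerivative

open Set Filter Topology

variable {d : ℕ} {S : Type*} [TopologicalSpace S] [ChartedSpace (EuclideanSpace ℝ (Fin d)) S]
  [IsManifold (𝓡 d) ω S]

theorem form_eq_localForm_comp (α : OneForm d S) {s₀ x : S}
    (hx : x ∈ (extChartAt (𝓡 d) s₀).source) (v : TangentSpace (𝓡 d) x) :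
    α x v = localForm α s₀ (extChartAt (𝓡 d) s₀ x) (chartDeriv s₀ x v) := by
  obtain ⟨y, hy, rfl⟩ : ∃ y ∈ (extChartAt (𝓡 d) s₀).target, (extChartAt (𝓡 d) s₀).symm y = x :=
    ⟨_, (extChartAt (𝓡 d) s₀).map_source hx, (extChartAt (𝓡 d) s₀).left_inv hx⟩
  rw [(extChartAt (𝓡 d) s₀).right_inv hy]
  change _ = α ((extChartAt (𝓡 d) s₀).symm y) (chartSymmDeriv s₀ y _)
  rw [chartSymmDeriv_comp_chartDeriv hy]

/-- The antisymmetrized derivative of a form `x ↦ a (τ x) ∘ τ' x` pulled back by a map `τ`. -/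
theorem antisymm_fderiv_pullback {E : Type*} [NormedAddCommGroup E] [NormedSpace ℝ E]
    [CompleteSpace E] {a : E → E →L[ℝ] ℝ} {τ : E → E} {z : E} (ha : DifferentiableAt ℝ a (τ z))
    (hτ : AnalyticAt ℝ τ z) {b : E → E →L[ℝ] ℝ} (hb : b =ᶠ[𝓝 z] fun x ↦ a (τ x) ∘L fderiv ℝ τ x)
    (u v : E) :
    fderiv ℝ b z u v - fderiv ℝ b z v u =
      fderiv ℝ a (τ z) (fderiv ℝ τ z u) (fderiv ℝ τ z v) -
        fderiv ℝ a (τ z) (fderiv ℝ τ z v) (fderiv ℝ τ z u) := by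
  have hsymm : IsSymmSndFDerivAt ℝ τ z :=
    (hτ.contDiffAt (n := ω)).isSymmSndFDerivAt (by simp)
  have hτ' : HasFDerivAt (fderiv ℝ τ) (fderiv ℝ (fderiv ℝ τ) z) z := by
    have h1 : ContDiffAt ℝ 1 (fderiv ℝ τ) z := (hτ.contDiffAt (n := 2)).fderiv_right (by norm_num)
    exact (h1.differentiableAt one_ne_zero).hasFDerivAt
  have h1 := ((ha.hasFDerivAt.comp z (hτ.differentiableAt.hasFDerivAt)).clm_comp hτ')
  have h2 := (h1.congr_of_eventuallyEq hb).fderiv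
  rw [h2]
  -- The term containing the second derivative of `τ` is symmetric and cancels.
  simp [hsymm v u]

/-- The exterior derivative may be computed in any chart. -/
theorem extDerivForm_eq_localForm {α : OneForm d S} (hα : AnalyticOneForm α) {s₀ x : S}
    (hxs : x ∈ (extChartAt (𝓡 d) s₀).source) (u v : TangentSpace (𝓡 d) x) :
    extDerivForm α x u v =
      fderiv ℝ (localForm α s₀) (extChartAt (𝓡 d) s₀ x) (chartDeriv s₀ x u) (chartDeriv s₀ x v) -
        fderiv ℝ (localForm α s₀) (extChartAt (𝓡 d) s₀ x) (chartDeriv s₀ x v)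
          (chartDeriv s₀ x u) := by
  set y := extChartAt (𝓡 d) s₀ x
  have hy : y ∈ (extChartAt (𝓡 d) s₀).target := (extChartAt (𝓡 d) s₀).map_source hxs
  set z := extChartAt (𝓡 d) x x
  have hz : z ∈ (extChartAt (𝓡 d) x).target := mem_extChartAt_target (I := 𝓡 d) x
  have hzx : (extChartAt (𝓡 d) x).symm z = x := extChartAt_to_inv (I := 𝓡 d) x
  set τ := inCharts (d := d) (id : S → S) x s₀
  have hτz : τ z = y := by
    simp only [τ, inCharts, Function.comp_apply, hzx, id, y]
  have hτ : AnalyticAt ℝ τ z := analyticAt_inCharts contMDiff_id hz (by rwa [hzx])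
  have hev : ∀ᶠ w in 𝓝 z, w ∈ (extChartAt (𝓡 d) x).target ∧
      (extChartAt (𝓡 d) x).symm w ∈ (extChartAt (𝓡 d) s₀).source := by
    refine ((isOpen_extChartAt_target x).eventually_mem hz).and ?_
    refine (continuousAt_extChartAt_symm x).eventually ?_
    rw [hzx]
    exact (isOpen_extChartAt_source s₀).mem_nhds hxs
  have hDτ : ∀ w, w ∈ (extChartAt (𝓡 d) x).target ∧
      (extChartAt (𝓡 d) x).symm w ∈ (extChartAt (𝓡 d) s₀).source →
      ∀ t, fderiv ℝ τ w (chartDeriv x ((extChartAt (𝓡 d) x).symm w) t) =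
        chartDeriv s₀ ((extChartAt (𝓡 d) x).symm w) t := by
    intro w hw t
    have := fderiv_inCharts_chartDeriv (φ := (id : S → S)) contMDiff_id hw.1 hw.2 t
    rw [mfderiv_id] at this
    exact this
  have hloc : localForm α x =ᶠ[𝓝 z] fun w ↦ localForm α s₀ (τ w) ∘L fderiv ℝ τ w := by
    filter_upwards [hev] with w hw
    ext t
    change α ((extChartAt (𝓡 d) x).symm w) (chartSymmDeriv x w t) = _
    rw [form_eq_localForm_comp α hw.2, ← hDτ w hw, chartDeriv_comp_chartSymmDeriv hw.1]
    rfl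
  have ha : DifferentiableAt ℝ (localForm α s₀) (τ z) := by
    rw [hτz]
    exact ((hα s₀).contDiffAt ((isOpen_extChartAt_target s₀).mem_nhds hy)).differentiableAt
      (by simp)
  have hmain := antisymm_fderiv_pullback ha hτ hloc (chartDeriv x x u) (chartDeriv x x v)
  have hD : ∀ t : TangentSpace (𝓡 d) x, fderiv ℝ τ z (chartDeriv x x t) = chartDeriv s₀ x t := by
    have h := hDτ z hev.self_of_nhds
    rw [hzx] at h
    exact h
  rw [hD, hD, hτz] at hmain
  exact hmain

end ExteriorDerivative

/-! ### Finite-dimensional duality. -/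

section FiniteDimensional

variable {X : Type*} [NormedAddCommGroup X] [NormedSpace ℝ X] [FiniteDimensional ℝ X]

theorem eq_zero_of_linearIndependent_covectors {k : ℕ} (hk : Module.finrank ℝ X = k)
    {β : Fin k → X →L[ℝ] ℝ} (hβ : LinearIndependent ℝ β) {v : X} (hv : ∀ i, β i v = 0) :
    v = 0 := by
  have hfin : Fintype.card (Fin k) = Module.finrank ℝ (X →L[ℝ] ℝ) := by
    have h1 : Module.finrank ℝ (X →L[ℝ] ℝ) = Module.finrank ℝ (X →ₗ[ℝ] ℝ) :=
      (LinearMap.toContinuousLinearMap (𝕜 := ℝ) (E := X) (F' := ℝ)).finrank_eq.symm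
    rw [h1, Fintype.card_fin]
    exact hk.symm.trans (Subspace.dual_finrank_eq (K := ℝ) (V := X)).symm
  have h3 := hβ.span_eq_top_of_card_eq_finrank' hfin
  by_contra hne
  obtain ⟨γ, hγ⟩ := SeparatingDual.exists_ne_zero (R := ℝ) hne
  have hmem : γ ∈ Submodule.span ℝ (Set.range β) := h3 ▸ Submodule.mem_top
  have hle : Submodule.span ℝ (Set.range β) ≤
      LinearMap.ker (ContinuousLinearMap.apply ℝ ℝ v : (X →L[ℝ] ℝ) →ₗ[ℝ] ℝ) :=
    Submodule.span_le.2 (by rintro _ ⟨i, rfl⟩; exact hv i)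
  exact hγ (hle hmem)

theorem exists_continuous_leftInverse {D : X →L[ℝ] X} (hD : Function.Injective D) :
    ∃ L : X →L[ℝ] X, ∀ u, L (D u) = u :=
  ⟨(LinearEquiv.ofInjectiveEndo (D : X →ₗ[ℝ] X) hD).symm.toLinearMap.toContinuousLinearMap,
    fun u ↦ (LinearEquiv.ofInjectiveEndo (D : X →ₗ[ℝ] X) hD).symm_apply_apply u⟩

end FiniteDimensional

/-! ### Regular points are those under which `φ` is a local diffeomorphism. -/

section Regular

variable {n : ℕ} {M : Type*} [TopologicalSpace M]
  [ChartedSpace (EuclideanSpace ℝ (Fin (2 * n + 1))) M]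
  {S : Type*} [TopologicalSpace S] [ChartedSpace (EuclideanSpace ℝ (Fin (2 * n + 1))) S]
  {πS : TwoTensorField (2 * n + 1) S} {ES : VectorField (2 * n + 1) S}
  {π : TwoTensorField (2 * n + 1) M} {E : VectorField (2 * n + 1) M} {φ : S → M}

/-- A Jacobi morphism is a local diffeomorphism over the regular points. -/
theorem IsAnalyticJacobiMorphism.injective_mfderiv
    (h : IsAnalyticJacobiMorphism πS ES π E φ) {s : S} (hs : IsRegularPoint π E (φ s)) :
    Function.Injective (mfderiv (𝓡 (2 * n + 1)) (𝓡 (2 * n + 1)) φ s) := by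
  obtain ⟨β, hβ⟩ := hs
  set D := mfderiv (𝓡 (2 * n + 1)) (𝓡 (2 * n + 1)) φ s
  -- Pullback by `D` preserves the value of `E ∧ π^n`, so the `2n + 1` pulled-back covectors are
  -- independent; all of them kill the kernel of `D`.
  have h1 := wedgePow_comp_eq (a := fun γ : CotangentSpace (2 * n + 1) s ↦ γ (ES s))
    (b := fun γ δ ↦ πS s γ δ) (a' := fun γ : CotangentSpace (2 * n + 1) (φ s) ↦ γ (E (φ s)))
    (b' := fun γ δ ↦ π (φ s) γ δ) (g := fun γ : CotangentSpace (2 * n + 1) (φ s) ↦ γ ∘L D)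
    (ε := 1) (fun γ ↦ by rw [← h.map_vector s]; rfl)
    (fun γ δ ↦ by rw [one_mul]; exact h.map_tensor s γ δ) β
  have h2 := linearIndependent_of_wedgePow_ne_zero
    (a := { toFun := fun γ : CotangentSpace (2 * n + 1) s ↦ γ (ES s)
            map_add' := fun _ _ ↦ rfl
            map_smul' := fun _ _ ↦ rfl })
    (b := LinearMap.mk₂ ℝ (fun γ δ ↦ πS s γ δ) (fun _ _ _ ↦ by simp) (fun _ _ _ ↦ by simp)
      (fun _ _ _ ↦ by simp) (fun _ _ _ ↦ by simp)) (n := n) (v := fun i ↦ β i ∘L D) (by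
      rw [one_pow, one_mul] at h1
      exact h1.trans_ne hβ)
  refine (injective_iff_map_eq_zero _).2 fun v hv ↦ ?_
  refine eq_zero_of_linearIndependent_covectors (X := EuclideanSpace ℝ (Fin (2 * n + 1)))
    (by simp) h2 (v := v) fun i ↦ ?_
  change β i (D v) = 0
  rw [hv, map_zero]

variable [IsManifold (𝓡 (2 * n + 1)) ω S] {α : OneForm (2 * n + 1) S}

theorem extDerivForm_skew (hα : AnalyticOneForm α) (s : S)
    (u v : TangentSpace (𝓡 (2 * n + 1)) s) :
    extDerivForm α s u v = - extDerivForm α s v u := by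
  rw [extDerivForm_eq_localForm hα (mem_extChartAt_source (I := 𝓡 (2 * n + 1)) s),
    extDerivForm_eq_localForm hα (mem_extChartAt_source (I := 𝓡 (2 * n + 1)) s)]
  ring

/-- The points over which a Jacobi morphism from a contact manifold is a local diffeomorphism are
regular. -/
theorem IsAnalyticJacobiMorphism.isRegularPoint (h : IsAnalyticJacobiMorphism πS ES π E φ)
    (hα : IsAnalyticContactForm α) (hJ : IsJacobiOfContactForm α πS ES) {s : S}
    (hs : Function.Injective (mfderiv (𝓡 (2 * n + 1)) (𝓡 (2 * n + 1)) φ s)) :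
    IsRegularPoint π E (φ s) := by
  obtain ⟨v, hv⟩ := hα.nondegenerate s
  have hskew := extDerivForm_skew hα.analytic s
  obtain ⟨L, hL⟩ : ∃ L : TangentSpace (𝓡 (2 * n + 1)) (φ s) →L[ℝ] TangentSpace (𝓡 (2 * n + 1)) s,
      ∀ u, L (mfderiv (𝓡 (2 * n + 1)) (𝓡 (2 * n + 1)) φ s u) = u :=
    exists_continuous_leftInverse (X := EuclideanSpace ℝ (Fin (2 * n + 1))) hs
  -- This is the contact isomorphism `♭`: it turns `E_S ∧ π_S^n` into `(-1)^n α ∧ (dα)^n`, and `L`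
  -- carries the covectors over to the target.
  set b : TangentSpace (𝓡 (2 * n + 1)) s → CotangentSpace (2 * n + 1) s := fun u ↦
    extDerivForm α s u + α s u • α s
  have hbE : ∀ u, b u (ES s) = α s u := by
    intro u
    change extDerivForm α s u (ES s) + α s u * α s (ES s) = _
    rw [hskew, hJ.extDeriv_reeb, hJ.form_reeb]
    simp
  have hπb : ∀ u γ, πS s (b u) γ = γ u - α s u * γ (ES s) := by
    intro u γ
    change πS s (extDerivForm α s u + α s u • α s) γ = _
    rw [map_add, map_smul, hJ.tensor_form, smul_zero, add_zero, hJ.tensor_extDeriv]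
  refine ⟨fun i ↦ b (v i) ∘L L, ?_⟩
  have h1 := wedgePow_comp_eq (n := n)
    (a := fun γ : CotangentSpace (2 * n + 1) (φ s) ↦ γ (E (φ s)))
    (b := fun γ δ ↦ π (φ s) γ δ) (a' := fun u ↦ α s u) (b' := fun u w ↦ extDerivForm α s u w)
    (g := fun u ↦ b u ∘L L) (ε := -1) (fun u ↦ by
      change b u (L (E (φ s))) = _
      rw [← h.map_vector s, hL, hbE]) (fun u w ↦ by
      rw [← h.map_tensor s]
      have hcomp : ∀ u, (b u ∘L L) ∘L mfderiv (𝓡 (2 * n + 1)) (𝓡 (2 * n + 1)) φ s = b u := by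
        intro u
        ext t
        exact congrArg (b u) (hL t)
      rw [hcomp, hcomp, hπb, hbE]
      change extDerivForm α s w u + α s w * α s u - _ = _
      rw [hskew w u]
      ring) v
  rw [h1]
  exact mul_ne_zero (pow_ne_zero _ (by norm_num)) hv

end Regular

/-! ### The contact Jacobi structure in a chart. -/

section ContactInCharts

variable {n : ℕ} {S : Type*} [TopologicalSpace S]
  [ChartedSpace (EuclideanSpace ℝ (Fin (2 * n + 1))) S] [IsManifold (𝓡 (2 * n + 1)) ω S]
  {πS : TwoTensorField (2 * n + 1) S} {ES : VectorField (2 * n + 1) S}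
  {α : OneForm (2 * n + 1) S}

/-- The Jacobi structure of a contact form, read in a chart. -/
theorem IsJacobiOfContactForm.isLinearContact (hJ : IsJacobiOfContactForm α πS ES)
    (hα : AnalyticOneForm α) {s₀ x : S} (hx : x ∈ (extChartAt (𝓡 (2 * n + 1)) s₀).source) :
    IsLinearContact (localForm α s₀ (extChartAt (𝓡 (2 * n + 1)) s₀ x))
      (fderiv ℝ (localForm α s₀) (extChartAt (𝓡 (2 * n + 1)) s₀ x) -
        (fderiv ℝ (localForm α s₀) (extChartAt (𝓡 (2 * n + 1)) s₀ x)).flip)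
      (fun β γ ↦ πS x (β ∘L chartDeriv s₀ x) (γ ∘L chartDeriv s₀ x))
      (chartDeriv s₀ x (ES x)) := by
  have hsurj : Function.Surjective (chartDeriv s₀ x) :=
    (isInvertible_mfderiv_extChartAt (I := 𝓡 (2 * n + 1)) hx).surjective
  have hform := form_eq_localForm_comp α hx
  have hd := extDerivForm_eq_localForm hα hx
  refine ⟨fun u v ↦ by simp, ?_, fun u ↦ ?_, fun u γ ↦ ?_⟩
  · rw [← hform, hJ.form_reeb]
  · obtain ⟨u, rfl⟩ := hsurj u
    have := hd (ES x) u
    rw [hJ.extDeriv_reeb] at this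
    exact this.symm
  · obtain ⟨u, rfl⟩ := hsurj u
    have h1 : (fderiv ℝ (localForm α s₀) (extChartAt (𝓡 (2 * n + 1)) s₀ x) -
        (fderiv ℝ (localForm α s₀) (extChartAt (𝓡 (2 * n + 1)) s₀ x)).flip) (chartDeriv s₀ x u) ∘L
          chartDeriv s₀ x = extDerivForm α x u := by
      ext v
      exact (hd u v).symm
    have h2 : localForm α s₀ (extChartAt (𝓡 (2 * n + 1)) s₀ x) ∘L chartDeriv s₀ x = α x := by
      ext v
      exact (hform v).symm
    rw [ContinuousLinearMap.add_comp, ContinuousLinearMap.smul_comp, h1, h2, map_add, map_smul,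
      hJ.tensor_form, smul_zero, add_zero, hJ.tensor_extDeriv, hform]
    rfl

end ContactInCharts

/-! ### The Jacobi structure of the target in a chart. -/

section TargetFields

open Filter Topology

variable {d : ℕ} {M : Type*} [TopologicalSpace M] [ChartedSpace (EuclideanSpace ℝ (Fin d)) M]
  [IsManifold (𝓡 d) ω M]

theorem mvfderiv_clm_comp_extChartAt {m₀ m : M} (hm : m ∈ (extChartAt (𝓡 d) m₀).source)
    (γ : EuclideanSpace ℝ (Fin d) →L[ℝ] ℝ) :
    mvfderiv (𝓡 d) (γ ∘ extChartAt (𝓡 d) m₀) m = γ ∘L chartDeriv m₀ m := by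
  rw [mvfderiv_comp_extChartAt hm γ.differentiableAt, γ.fderiv]

theorem contMDiffAt_clm_comp_extChartAt {m₀ m : M} (hm : m ∈ (extChartAt (𝓡 d) m₀).source)
    (γ : EuclideanSpace ℝ (Fin d) →L[ℝ] ℝ) :
    ContMDiffAt (𝓡 d) 𝓘(ℝ, ℝ) ω (γ ∘ extChartAt (𝓡 d) m₀) m :=
  γ.contMDiff.contMDiffAt.comp m
    (contMDiffAt_extChartAt' (by rwa [extChartAt_source] at hm))

theorem contDiffAt_comp_extChartAt_symm {m₀ m : M} (hm : m ∈ (extChartAt (𝓡 d) m₀).source)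
    {f : M → ℝ} (hf : ContMDiffAt (𝓡 d) 𝓘(ℝ, ℝ) ω f m) :
    ContDiffAt ℝ 1 (f ∘ (extChartAt (𝓡 d) m₀).symm) (extChartAt (𝓡 d) m₀ m) := by
  have h1 : ContMDiffAt 𝓘(ℝ, EuclideanSpace ℝ (Fin d)) (𝓡 d) ω (extChartAt (𝓡 d) m₀).symm
      (extChartAt (𝓡 d) m₀ m) :=
    (contMDiffOn_extChartAt_symm m₀).contMDiffAt
      ((isOpen_extChartAt_target m₀).mem_nhds ((extChartAt (𝓡 d) m₀).map_source hm))
  have h2 : ContMDiffAt (𝓡 d) 𝓘(ℝ, ℝ) ω f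
      ((extChartAt (𝓡 d) m₀).symm (extChartAt (𝓡 d) m₀ m)) := by
    rwa [(extChartAt (𝓡 d) m₀).left_inv hm]
  exact ((h2.comp _ h1).contDiffAt).of_le (by simp)

/-- An analytic vector field is continuously differentiable in charts. -/
theorem AnalyticVectorField.exists_inChart {E : VectorField d M} (hE : AnalyticVectorField E)
    {m₀ m : M} (hm : m ∈ (extChartAt (𝓡 d) m₀).source) :
    ∃ Ξ : EuclideanSpace ℝ (Fin d) → EuclideanSpace ℝ (Fin d),
      ContDiffAt ℝ 1 Ξ (extChartAt (𝓡 d) m₀ m) ∧ ∀ m' ∈ (extChartAt (𝓡 d) m₀).source,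
        chartDeriv m₀ m' (E m') = Ξ (extChartAt (𝓡 d) m₀ m') := by
  refine ⟨fun w ↦ WithLp.toLp 2 fun i ↦
    lieDeriv E (EuclideanSpace.proj i ∘ extChartAt (𝓡 d) m₀) ((extChartAt (𝓡 d) m₀).symm w),
    contDiffAt_euclidean.2 fun i ↦ ?_, fun m' hm' ↦ ?_⟩
  · exact contDiffAt_comp_extChartAt_symm hm
      (hE m _ (contMDiffAt_clm_comp_extChartAt hm (EuclideanSpace.proj i)))
  · ext i
    change _ = lieDeriv E _ ((extChartAt (𝓡 d) m₀).symm (extChartAt (𝓡 d) m₀ m'))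
    rw [(extChartAt (𝓡 d) m₀).left_inv hm', lieDeriv]
    have := mvfderiv_clm_comp_extChartAt hm' (EuclideanSpace.proj i)
    rw [this]
    rfl

/-- The contraction of an analytic tensor field with a constant covector is continuously
differentiable in charts. -/
theorem AnalyticTwoTensorField.exists_inChart {π : TwoTensorField d M}
    (hπ : AnalyticTwoTensorField π) {m₀ m : M} (hm : m ∈ (extChartAt (𝓡 d) m₀).source)
    (γ : EuclideanSpace ℝ (Fin d) →L[ℝ] ℝ) :
    ∃ Ξ : EuclideanSpace ℝ (Fin d) → EuclideanSpace ℝ (Fin d),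
      ContDiffAt ℝ 1 Ξ (extChartAt (𝓡 d) m₀ m) ∧ ∀ m' ∈ (extChartAt (𝓡 d) m₀).source,
        ∀ δ : EuclideanSpace ℝ (Fin d) →L[ℝ] ℝ,
          π m' (γ ∘L chartDeriv m₀ m') (δ ∘L chartDeriv m₀ m') =
            δ (Ξ (extChartAt (𝓡 d) m₀ m')) := by
  refine ⟨fun w ↦ WithLp.toLp 2 fun i ↦ bracket π (γ ∘ extChartAt (𝓡 d) m₀)
    (EuclideanSpace.proj i ∘ extChartAt (𝓡 d) m₀) ((extChartAt (𝓡 d) m₀).symm w),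
    contDiffAt_euclidean.2 fun i ↦ ?_, fun m' hm' δ ↦ ?_⟩
  · exact contDiffAt_comp_extChartAt_symm hm (hπ m _ _ (contMDiffAt_clm_comp_extChartAt hm γ)
      (contMDiffAt_clm_comp_extChartAt hm (EuclideanSpace.proj i)))
  · beta_reduce
    rw [(extChartAt (𝓡 d) m₀).left_inv hm']
    have hδ : ∀ x : EuclideanSpace ℝ (Fin d),
        δ x = ∑ i, x i * δ (EuclideanSpace.single i 1) := by
      intro x
      conv_lhs => rw [← (EuclideanSpace.basisFun (Fin d) ℝ).sum_repr x]
      simp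
    have hδ' : δ ∘L chartDeriv m₀ m' = ∑ i, δ (EuclideanSpace.single i 1) •
        ((EuclideanSpace.proj i : EuclideanSpace ℝ (Fin d) →L[ℝ] ℝ) ∘L chartDeriv m₀ m') := by
      ext v
      rw [ContinuousLinearMap.comp_apply, hδ, sum_apply]
      refine Finset.sum_congr rfl fun i _ ↦ ?_
      exact mul_comm _ _
    rw [hδ', hδ, map_sum]
    refine Finset.sum_congr rfl fun i _ ↦ ?_
    rw [map_smul, smul_eq_mul, mul_comm]
    congr 1
    simp only [bracket]
    rw [mvfderiv_clm_comp_extChartAt hm' γ]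
    have := mvfderiv_clm_comp_extChartAt hm' (EuclideanSpace.proj i)
    rw [this]

end TargetFields

/-! ### The critical set of an analytic map. -/

section SingularSet

open Filter Topology

theorem eventually_mem_chart_domains {d : ℕ} {M S : Type*} [TopologicalSpace M]
    [TopologicalSpace S] [ChartedSpace (EuclideanSpace ℝ (Fin d)) S] {φ : S → M}
    (hφ : Continuous φ) (s : S) {O : Set M} (hO : IsOpen O)
    (hs : φ s ∈ O) :
    ∀ᶠ y in 𝓝 (extChartAt (𝓡 d) s s), y ∈ (extChartAt (𝓡 d) s).target ∧
      φ ((extChartAt (𝓡 d) s).symm y) ∈ O := by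
  refine ((isOpen_extChartAt_target s).eventually_mem (mem_extChartAt_target (I := 𝓡 d) s)).and ?_
  have h1 : ∀ᶠ t in 𝓝 ((extChartAt (𝓡 d) s).symm (extChartAt (𝓡 d) s s)), φ t ∈ O := by
    rw [extChartAt_to_inv (I := 𝓡 d) s]
    exact hφ.continuousAt.eventually (hO.mem_nhds hs)
  exact (continuousAt_extChartAt_symm (I := 𝓡 d) s).eventually h1

/-- By the Leibniz formula the determinant is a polynomial in the matrix entries. -/
theorem _root_.AnalyticAt.clm_det {ι V : Type*} [Fintype ι] [NormedAddCommGroup V] [NormedSpace ℝ V]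
    {L : V → EuclideanSpace ℝ ι →L[ℝ] EuclideanSpace ℝ ι} {y : V} (hL : AnalyticAt ℝ L y) :
    AnalyticAt ℝ (fun z ↦ (L z).det) y := by
  classical
  set b := (EuclideanSpace.basisFun ι ℝ).toBasis
  have h1 : (fun z ↦ (L z).det) = fun z ↦ ∑ σ : Equiv.Perm ι, ((Equiv.Perm.sign σ : ℤ) : ℝ) *
      ∏ i, L z (b i) (σ i) := by
    funext z
    rw [ContinuousLinearMap.det, ← LinearMap.det_toMatrix b, Matrix.det_apply]
    refine Finset.sum_congr rfl fun σ _ ↦ ?_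
    rw [Units.smul_def, zsmul_eq_mul]
    congr 1
  rw [h1]
  refine Finset.analyticAt_fun_sum _ fun σ _ ↦ analyticAt_const.mul
    (Finset.analyticAt_fun_prod _ fun i _ ↦ ?_)
  exact ((EuclideanSpace.proj (σ i) : EuclideanSpace ℝ ι →L[ℝ] ℝ) ∘L
    ContinuousLinearMap.apply ℝ (EuclideanSpace ℝ ι) (b i)).analyticAt _ |>.comp hL

theorem clm_injective_iff_det_ne_zero {V : Type*} [NormedAddCommGroup V] [NormedSpace ℝ V]
    [FiniteDimensional ℝ V] (L : V →L[ℝ] V) : Function.Injective L ↔ L.det ≠ 0 := by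
  rw [← isUnit_iff_ne_zero, ContinuousLinearMap.det, ← LinearMap.isUnit_iff_isUnit_det,
    LinearMap.isUnit_iff_ker_eq_bot, LinearMap.ker_eq_bot]
  rfl

variable {d : ℕ} {M : Type*} [TopologicalSpace M] [ChartedSpace (EuclideanSpace ℝ (Fin d)) M]
  [IsManifold (𝓡 d) ω M] {S : Type*} [TopologicalSpace S]
  [ChartedSpace (EuclideanSpace ℝ (Fin d)) S] [IsManifold (𝓡 d) ω S] {φ : S → M}

theorem injective_mfderiv_iff_det_ne_zero (hφ : ContMDiff (𝓡 d) (𝓡 d) ω φ) {s₀ : S} {x₀ : M}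
    {y : EuclideanSpace ℝ (Fin d)} (hy : y ∈ (extChartAt (𝓡 d) s₀).target)
    (hx : φ ((extChartAt (𝓡 d) s₀).symm y) ∈ (extChartAt (𝓡 d) x₀).source) :
    Function.Injective (mfderiv (𝓡 d) (𝓡 d) φ ((extChartAt (𝓡 d) s₀).symm y)) ↔
      (fderiv ℝ (inCharts φ s₀ x₀) y).det ≠ 0 := by
  rw [← injective_fderiv_inCharts_iff hφ hy hx, clm_injective_iff_det_ne_zero]

/-- If an analytic map is somewhere a local diffeomorphism on each connected component, then it is
so on a dense set. -/
theorem not_eventually_not_injective_mfderiv (hφ : ContMDiff (𝓡 d) (𝓡 d) ω φ)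
    (h : ∀ s : S, ∃ t ∈ connectedComponent s, Function.Injective (mfderiv (𝓡 d) (𝓡 d) φ t)) (s : S) :
    ¬ ∀ᶠ t in 𝓝 s, ¬ Function.Injective (mfderiv (𝓡 d) (𝓡 d) φ t) := by
  intro hs
  -- The interior of the critical set is closed as well as open: on a chart ball, a Jacobian
  -- determinant vanishing near one point vanishes throughout.
  set G : Set S := {s | ∀ᶠ t in 𝓝 s, ¬ Function.Injective (mfderiv (𝓡 d) (𝓡 d) φ t)}
  have hopen : IsOpen G := isOpen_setOfPred_eventually_nhds
  have hclosed : IsClosed G := by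
    refine isClosed_of_closure_subset fun s hs ↦ ?_
    obtain ⟨ε, hε, hB⟩ := Metric.eventually_nhds_iff_ball.1
      (eventually_mem_chart_domains (d := d) hφ.continuous s
        (isOpen_extChartAt_source (I := 𝓡 d) (φ s)) (mem_extChartAt_source (I := 𝓡 d) (φ s)))
    set B := Metric.ball (extChartAt (𝓡 d) s s) ε
    set f : EuclideanSpace ℝ (Fin d) → ℝ := fun y ↦ (fderiv ℝ (inCharts φ s (φ s)) y).det
    have hf : AnalyticOnNhd ℝ f B := fun y hy ↦
      (analyticAt_inCharts hφ (hB y hy).1 (hB y hy).2).fderiv.clm_det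
    have hnhds : (extChartAt (𝓡 d) s).source ∩ extChartAt (𝓡 d) s ⁻¹' B ∈ 𝓝 s :=
      inter_mem (extChartAt_source_mem_nhds (I := 𝓡 d) s)
        ((continuousAt_extChartAt (I := 𝓡 d) s).preimage_mem_nhds (Metric.ball_mem_nhds _ hε))
    obtain ⟨t, ⟨hts, htB⟩, htG⟩ := mem_closure_iff_nhds.1 hs _ hnhds
    have hf0 : ∀ᶠ y in 𝓝 (extChartAt (𝓡 d) s t), f y = 0 := by
      have h1 : ∀ᶠ y in 𝓝 (extChartAt (𝓡 d) s t), ¬ Function.Injective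
          (mfderiv (𝓡 d) (𝓡 d) φ ((extChartAt (𝓡 d) s).symm y)) := by
        have h0 : ∀ᶠ t' in 𝓝 ((extChartAt (𝓡 d) s).symm (extChartAt (𝓡 d) s t)),
            ¬ Function.Injective (mfderiv (𝓡 d) (𝓡 d) φ t') := by
          rw [(extChartAt (𝓡 d) s).left_inv hts]
          exact htG
        exact (continuousAt_extChartAt_symm' hts).eventually h0
      filter_upwards [h1, Metric.isOpen_ball.mem_nhds htB] with y hy hyB
      by_contra hne
      exact hy ((injective_mfderiv_iff_det_ne_zero hφ (hB y hyB).1 (hB y hyB).2).2 hne)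
    have hzero := hf.eqOn_zero_of_preconnected_of_eventuallyEq_zero
      (convex_ball _ _).isPreconnected htB hf0
    filter_upwards [hnhds] with t' ht' hinj
    have h2 := hB _ ht'.2
    have h3 := injective_mfderiv_iff_det_ne_zero hφ h2.1 h2.2
    rw [(extChartAt (𝓡 d) s).left_inv ht'.1] at h3
    exact h3.1 hinj (hzero ht'.2)
  obtain ⟨t, ht, hinj⟩ := h s
  have hG : IsClopen G := ⟨hclosed, hopen⟩
  exact (hG.connectedComponent_subset hs ht).self_of_nhds hinj

end SingularSet

/-! ### Straightening a submanifold. -/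

section Straightening

open Set Filter Topology MeasureTheory

theorem _root_.ContinuousAt.sub_flip {X V : Type*} [TopologicalSpace X] [NormedAddCommGroup V]
    [NormedSpace ℝ V] {g : X → V →L[ℝ] V →L[ℝ] ℝ} {x : X} (hg : ContinuousAt g x) :
    ContinuousAt (fun y ↦ g y - (g y).flip) x := by
  have h : IsTopologicalAddGroup (V →L[ℝ] V →L[ℝ] ℝ) := inferInstance
  have : ContinuousSub (V →L[ℝ] V →L[ℝ] ℝ) := h.to_continuousSub
  exact hg.sub ((ContinuousLinearMap.flipₗᵢ ℝ V V ℝ).continuous.continuousAt.comp hg)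

/-- An immersed submanifold is locally parametrized by the values of a smooth map on the ambient
manifold. -/
theorem exists_straightening {k d : ℕ} {M : Type*} [TopologicalSpace M]
    [ChartedSpace (EuclideanSpace ℝ (Fin d)) M] [IsManifold (𝓡 d) ω M] {N : Type*}
    [TopologicalSpace N] [ChartedSpace (EuclideanSpace ℝ (Fin k)) N] {i : N → M} {x : N}
    (h : Manifold.IsImmersionAt (𝓡 k) (𝓡 d) ∞ i x) :
    ∃ (O : Set M) (ρ : M → EuclideanSpace ℝ (Fin k)), IsOpen O ∧
      ContMDiffOn (𝓡 d) 𝓘(ℝ, EuclideanSpace ℝ (Fin k)) ∞ ρ O ∧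
      volume (ρ '' (O ∩ range i)) ≠ 0 := by
  -- In adapted charts `i` reads `u ↦ (u, 0)`. Projecting to the first factor recovers `u`, so the
  -- image contains the nonempty open target of the chart of `N`.
  set L : EuclideanSpace ℝ (Fin d) →L[ℝ] EuclideanSpace ℝ (Fin k) :=
    ContinuousLinearMap.fst ℝ (EuclideanSpace ℝ (Fin k)) h.complement ∘L
      h.equiv.symm.toContinuousLinearMap
  refine ⟨h.codChart.source, L ∘ h.codChart.extend (𝓡 d), h.codChart.open_source,
    L.contMDiff.comp_contMDiffOn (h.codChart.contMDiffOn_extend h.codChart_mem_maximalAtlas), ?_⟩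
  have hsub : (h.domChart.extend (𝓡 k)).target ⊆
      (L ∘ h.codChart.extend (𝓡 d)) '' (h.codChart.source ∩ range i) := by
    intro u hu
    have h1 := h.writtenInCharts hu
    have h2 : (h.domChart.extend (𝓡 k)).symm u ∈ h.domChart.source := by
      have := (h.domChart.extend (𝓡 k)).map_target hu
      rwa [h.domChart.extend_source] at this
    refine ⟨_, ⟨h.source_subset_preimage_source h2, mem_range_self _⟩, ?_⟩
    change (h.equiv.symm ((h.codChart.extend (𝓡 d) ∘ i ∘ (h.domChart.extend (𝓡 k)).symm) u)).1 = u
    rw [h1]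
    simp
  have hopen : IsOpen (h.domChart.extend (𝓡 k)).target := h.domChart.isOpen_extend_target
  have hne : ((h.domChart.extend (𝓡 k)).target).Nonempty :=
    ⟨_, (h.domChart.extend (𝓡 k)).map_source (x := x) (by
      rw [h.domChart.extend_source]; exact h.mem_domChart_source)⟩
  exact ((hopen.measure_pos volume hne).trans_le (measure_mono hsub)).ne'

end Straightening

end JacobiContact

/-! ### The main theorem. -/

open Set Filter Topology MeasureTheory in
theorem theorem4 {n : ℕ}
    {M : Type*} [TopologicalSpace M] [T2Space M] [SecondCountableTopology M]
    [ChartedSpace (EuclideanSpace ℝ (Fin (2 * n + 1))) M] [IsManifold (𝓡 (2 * n + 1)) ω M]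
    (π : TwoTensorField (2 * n + 1) M) (E : VectorField (2 * n + 1) M)
    (hJacobi : IsAnalyticJacobi π E) (hcontact : IsContactOnDenseOpen π E)
    {N : Type*} [TopologicalSpace N] [Nonempty N]
    [ChartedSpace (EuclideanSpace ℝ (Fin (2 * n))) N] [IsManifold (𝓡 (2 * n)) ∞ N]
    (i : N → M) (hi : Manifold.IsSmoothEmbedding (𝓡 (2 * n)) (𝓡 (2 * n + 1)) ∞ i)
    (hN : Set.range i ⊆ singularLocus π E)
    {S : Type*} [TopologicalSpace S] [T2Space S] [SecondCountableTopology S]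
    [ChartedSpace (EuclideanSpace ℝ (Fin (2 * n + 1))) S] [IsManifold (𝓡 (2 * n + 1)) ω S] :
    ¬ ∃ (α : OneForm (2 * n + 1) S) (φ : S → M),
      IsContactResolution π E α φ ∧ IsSemiConnected π E φ := by
  rintro ⟨α, φ, hres, hsemi⟩
  obtain ⟨πS, ES, hJ, hmor⟩ := hres.morphism
  have hφ := hmor.analytic
  have hα := hres.contact.analytic
  have hreg : ∀ s, IsRegularPoint π E (φ s) ↔
      Function.Injective (mfderiv (𝓡 (2 * n + 1)) (𝓡 (2 * n + 1)) φ s) := fun s ↦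
    ⟨hmor.injective_mfderiv, hmor.isRegularPoint hres.contact hJ⟩
  have hdense := not_eventually_not_injective_mfderiv hφ fun s ↦ by
    obtain ⟨_, ⟨t, ht, rfl⟩, hts⟩ := not_subset.1 (hsemi s)
    exact ⟨t, ht, (hreg t).1 (not_not.1 hts)⟩
  obtain ⟨O, ρ, hO, hρ, hvol⟩ := exists_straightening (hi.isImmersion.isImmersionAt
    (Classical.arbitrary N))
  set C : Set S := {s | φ s ∈ O ∧ ¬ IsRegularPoint π E (φ s)} with hC
  -- Surjectivity of `φ` lifts every point of the submanifold in `O` to a point of `C`.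
  have hCvol : OuterMeasure.comap (ρ ∘ φ) volume.toOuterMeasure C ≠ 0 := by
    rw [OuterMeasure.comap_apply]
    refine fun h0 ↦ hvol (measure_mono_null ?_ h0)
    rintro _ ⟨_, ⟨hxO, x, rfl⟩, rfl⟩
    obtain ⟨s, hs⟩ := hres.surjective (i x)
    refine ⟨s, ⟨hs ▸ hxO, ?_⟩, by simp [hs]⟩
    rw [hs]
    exact hN (mem_range_self x)
  -- Second countability localizes the positive measure at one point `s₀`, so that a single chart
  -- suffices.
  obtain ⟨s₀, hs₀, hpos⟩ := exists_mem_forall_mem_nhdsWithin_pos_measure hCvol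
  set κ := extChartAt (𝓡 (2 * n + 1)) s₀
  set κ' := extChartAt (𝓡 (2 * n + 1)) (φ s₀)
  obtain ⟨ε, hε, hB⟩ := Metric.eventually_nhds_iff_ball.1
    (eventually_mem_chart_domains (d := 2 * n + 1) hφ.continuous s₀
      (hO.inter (isOpen_extChartAt_source (I := 𝓡 (2 * n + 1)) (φ s₀)))
      ⟨hs₀.1, mem_extChartAt_source (I := 𝓡 (2 * n + 1)) (φ s₀)⟩)
  set B := Metric.ball (κ s₀) ε
  set ψ : EuclideanSpace ℝ (Fin (2 * n + 1)) → EuclideanSpace ℝ (Fin (2 * n + 1)) :=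
    inCharts φ s₀ (φ s₀) with hψdef
  have hψ : ∀ y ∈ B, AnalyticAt ℝ ψ y := fun y hy ↦
    analyticAt_inCharts hφ (hB y hy).1 (hB y hy).2.2
  set f : EuclideanSpace ℝ (Fin (2 * n + 1)) → ℝ := fun y ↦ (fderiv ℝ ψ y).det
  have hf : AnalyticOnNhd ℝ f B := fun y hy ↦ (hψ y hy).fderiv.clm_det
  have hf0 : ∀ y ∈ B, f y = 0 ↔ ¬ IsRegularPoint π E (φ (κ.symm y)) := fun y hy ↦ by
    rw [hreg, injective_mfderiv_iff_det_ne_zero hφ (hB y hy).1 (hB y hy).2.2, not_not]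
  have hne : ∀ y ∈ B, ¬ ∀ᶠ z in 𝓝 y, f z = 0 := by
    intro y hy hzero
    have hsrc := κ.map_target (hB y hy).1
    have hlim : Tendsto κ (𝓝 (κ.symm y)) (𝓝 y) := by
      have := (continuousAt_extChartAt' hsrc).tendsto
      rwa [κ.right_inv (hB y hy).1] at this
    refine hdense (κ.symm y) ?_
    filter_upwards [hlim.eventually hzero, hlim.eventually (Metric.isOpen_ball.mem_nhds hy),
      (isOpen_extChartAt_source (I := 𝓡 (2 * n + 1)) s₀).mem_nhds hsrc] with t ht htB hts
    rw [← hreg]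
    have := (hf0 _ htB).1 ht
    rwa [κ.left_inv hts] at this
  set ρ' : EuclideanSpace ℝ (Fin (2 * n + 1)) → EuclideanSpace ℝ (Fin (2 * n)) := ρ ∘ κ'.symm
  have hρ' : ∀ y ∈ B, DifferentiableAt ℝ ρ' (ψ y) := by
    intro y hy
    have hy' : ψ y ∈ κ'.target := κ'.map_source (hB y hy).2.2
    have h1 : κ'.symm (ψ y) = φ (κ.symm y) := κ'.left_inv (hB y hy).2.2
    have h2 : ContMDiffAt 𝓘(ℝ, EuclideanSpace ℝ (Fin (2 * n + 1))) (𝓡 (2 * n + 1)) ∞ κ'.symm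
        (ψ y) :=
      (contMDiffOn_extChartAt_symm (φ s₀)).contMDiffAt
        ((isOpen_extChartAt_target (φ s₀)).mem_nhds hy')
    have h3 : ContMDiffAt (𝓡 (2 * n + 1)) 𝓘(ℝ, EuclideanSpace ℝ (Fin (2 * n))) ∞ ρ
        (κ'.symm (ψ y)) := hρ.contMDiffAt (hO.mem_nhds (by rw [h1]; exact (hB y hy).2.1))
    exact (h3.comp _ h2).contDiffAt.differentiableAt (by simp)
  have hΘd : ∀ y ∈ B, HasFDerivAt (ρ' ∘ ψ) (fderiv ℝ ρ' (ψ y) ∘L fderiv ℝ ψ y) y := fun y hy ↦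
    (hρ' y hy).hasFDerivAt.comp y (hψ y hy).differentiableAt.hasFDerivAt
  have hμ : volume ((ρ' ∘ ψ) '' {y ∈ B | f y = 0}) ≠ 0 := by
    have hmem : C ∩ (κ.source ∩ κ ⁻¹' B) ∈ 𝓝[C] s₀ :=
      inter_mem self_mem_nhdsWithin (mem_nhdsWithin_of_mem_nhds
        (inter_mem (extChartAt_source_mem_nhds (I := 𝓡 (2 * n + 1)) s₀)
          ((continuousAt_extChartAt (I := 𝓡 (2 * n + 1)) s₀).preimage_mem_nhds
            (Metric.ball_mem_nhds _ hε))))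
    have h1 := hpos _ hmem
    rw [OuterMeasure.comap_apply] at h1
    refine (h1.trans_le (measure_mono ?_)).ne'
    rintro _ ⟨s, ⟨hsC, hsκ, hsB⟩, rfl⟩
    have h2 : κ.symm (κ s) = s := κ.left_inv hsκ
    refine ⟨κ s, ⟨hsB, (hf0 _ hsB).2 (by rw [h2]; exact hsC.2)⟩, ?_⟩
    have h3 : κ'.symm (ψ (κ s)) = φ (κ.symm (κ s)) := κ'.left_inv (hB _ hsB).2.2
    change ρ (κ'.symm (ψ (κ s))) = ρ (φ s)
    rw [h3, h2]
  obtain ⟨x, hx, p, hp, hp0, hp1, hpf, hpΘ⟩ := exists_hypersurface_of_image_zeros_ne_zero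
    (volume : Measure (EuclideanSpace ℝ (Fin (2 * n)))) (by simp) Metric.isOpen_ball hf hne
    (fun y hy ↦ (hΘd y hy).differentiableAt.differentiableWithinAt) hμ
  have hBx : ∀ᶠ y in 𝓝 x, y ∈ B := Metric.isOpen_ball.mem_nhds hx
  have hα' : ContDiffAt ℝ ω (localForm α s₀) x :=
    (hα s₀).contDiffAt ((isOpen_extChartAt_target s₀).mem_nhds (hB x hx).1)
  have hdα : ContinuousAt (fderiv ℝ (localForm α s₀)) x :=
    (hα'.fderiv_right (m := 0) (by simp)).continuousAt
  have hinj : ∀ y, ¬ Function.Injective (fderiv ℝ ψ y) ↔ f y = 0 := fun y ↦ by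
    rw [clm_injective_iff_det_ne_zero, not_not]
  -- With `A = dρ'` at `ψ x`, the composite `A ∘ dψ` is the derivative of `ρ' ∘ ψ`, immersive along
  -- `p = 0` by `hpΘ`. The conclusion would make the Jacobian determinant vanish near `x`, against
  -- `hne`.
  refine hne x hx (((not_injective_fderiv_of_contact (φ := ψ) (p := p) (x₀ := x)
    (A := fderiv ℝ ρ' (ψ x)) (a := localForm α s₀)
    (w := fun y ↦ fderiv ℝ (localForm α s₀) y - (fderiv ℝ (localForm α s₀) y).flip)
    (P := fun y β γ ↦ πS (κ.symm y) (β ∘L chartDeriv s₀ (κ.symm y))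
      (γ ∘L chartDeriv s₀ (κ.symm y)))
    (e := fun y ↦ chartDeriv s₀ (κ.symm y) (ES (κ.symm y))) (by simp) (hψ x hx) hp hp0 hp1
    ?_ ?_ hα'.continuousAt ?_ ?_ ?_ ?_)).mono fun y hy ↦ (hinj y).1 hy)
  · intro v hv hv'
    refine hpΘ v hv ?_
    rw [(hΘd x hx).fderiv]
    exact hv'
  · filter_upwards [hpf] with y hy hy0 using (hinj y).2 (hy hy0)
  · exact hdα.sub_flip
  · filter_upwards [hBx] with y hy
    have := hJ.isLinearContact hα (s₀ := s₀) (κ.map_target (hB y hy).1)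
    rwa [κ.right_inv (hB y hy).1] at this
  · obtain ⟨Ξ, hΞ, hrel⟩ := hJacobi.analytic_vector.exists_inChart (hB x hx).2.2
    refine ⟨Ξ, hΞ, ?_⟩
    filter_upwards [hBx] with y hy
    rw [fderiv_inCharts_chartDeriv hφ (hB y hy).1 (hB y hy).2.2]
    have := hrel _ (hB y hy).2.2
    rw [← hmor.map_vector] at this
    exact this
  · intro γ
    obtain ⟨Ξ, hΞ, hrel⟩ := hJacobi.analytic_tensor.exists_inChart (hB x hx).2.2 γ
    refine ⟨Ξ, hΞ, ?_⟩
    filter_upwards [hBx] with y hy δ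
    have hcomp : ∀ β : EuclideanSpace ℝ (Fin (2 * n + 1)) →L[ℝ] ℝ,
        (β ∘L fderiv ℝ ψ y) ∘L chartDeriv s₀ (κ.symm y) =
          (β ∘L chartDeriv (φ s₀) (φ (κ.symm y))) ∘L
            mfderiv (𝓡 (2 * n + 1)) (𝓡 (2 * n + 1)) φ (κ.symm y) := by
      intro β
      ext v
      exact congrArg β (fderiv_inCharts_chartDeriv hφ (hB y hy).1 (hB y hy).2.2 v)
    rw [hcomp, hcomp, hmor.map_tensor]
    exact hrel _ (hB y hy).2.2 δ
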